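/- Let $2\le q<p$ be real numbers and write $r'=r/(r-1)$ for the conjugate exponent of $r>1$. Let $f:[0,1]\to\mathbb R$ be a $C^1$ function with $f(0)=f(1)=0$ and $f>0$ on $(0,1)$. Assume that $$\lim_{s\to0^+}\frac{f(s)}{s^{q'-1}}=L_0,\qquad \sup_{s\in(0,1]}\frac{f(s)}{s^{q'-1}}=L_+<+\infty,$$ and that there is $k>0$ with $f(s)\le k(1-s)$ for all $s\in[0,1]$. For $c\in\mathbb R$, a monotone front of speed $c$ is a nondecreasing function $v\in C^1(\mathbb R)$ such that $|v'|^{p-2}v'+|v'|^{q-2}v'$ is $C^1$ and $$(|v'|^{p-2}v'+|v'|^{q-2}v')'-cv'+f(v)=0\ \text{ on }\mathbb R,\qquad v(-\infty)=0,\quad v(+\infty)=1.$$ Then there is a critical speed $c^*\in\mathbb R$ with $$L_0^{1/q'}\,(q')^{1/q'}\,q^{1/q}\le c^*\le c_+,$$ where $$c_+=\begin{cases}\dfrac{L_+^{1/q'}\,q}{q-1}\,(p+q-2)^{1/q} & \text{if } L_+\le p+q-2,\\[2mm] \dfrac{p(p+q-2)}{q-1} & \text{if } p+q-2<L_+\le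 \frac{p-1}{q-1}(p+q-2),\\[2mm] \dfrac{L_+^{1/p'}\,p}{(q-1)^{1/p}(p-1)^{(p-1)/p}}\,(p+q-2)^{1/p} & \text{if } L_+>\frac{p-1}{q-1}(p+q-2),\end{cases}$$ such that a monotone front of speed $c$ exists if and only if $c\ge c^*$. Moreover, for $c\ge c^*$ there is such a front with $v'>0$ on all of $\mathbb R$ whenever $q=2$, or $c>c^*$, or $c=c_+$. -/

import Mathlib

open Set Filter Topology

/-- The flux `|s|^(p-2) s + |s|^(q-2) s` of the one-dimensional `(p,q)`-Laplacian. -/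
noncomputable def pqFlux (p q s : ℝ) : ℝ :=
  |s| ^ (p - 2) * s + |s| ^ (q - 2) * s

/-- The reaction term is of Fisher type: a `C¹` function on `[0,1]` that vanishes at `0` and `1`
and is positive in between. Only the values of `f` on `[0,1]` matter. -/
structure IsFisherType (f : ℝ → ℝ) : Prop where
  contDiffOn : ContDiffOn ℝ 1 f (Icc 0 1)
  map_zero : f 0 = 0
  map_one : f 1 = 0
  pos : ∀ u ∈ Ioo (0 : ℝ) 1, 0 < f u

/-- `v` is a monotone front of speed `c`: a nondecreasing classical solution on the whole line of
`(|v'|^(p-2) v' + |v'|^(q-2) v')' - c v' + f(v) = 0` with `v(-∞) = 0` and `v(+∞) = 1`.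
(Such a `v` takes values in `[0,1]`; both `v` and the flux are then automatically `C¹`.) -/
structure IsMonotoneFront (p q : ℝ) (f : ℝ → ℝ) (c : ℝ) (v : ℝ → ℝ) : Prop where
  differentiable : Differentiable ℝ v
  monotone : Monotone v
  ode : ∀ z, ∃ w, HasDerivAt (fun x => pqFlux p q (deriv v x)) w z ∧
    w - c * deriv v z + f (v z) = 0
  tendsto_atBot : Tendsto v atBot (𝓝 0)
  tendsto_atTop : Tendsto v atTop (𝓝 1)

/-- `v` is a front of speed `c` with `v' > 0` on the whole line. -/
def IsStrictFront (p q : ℝ) (f : ℝ → ℝ) (c : ℝ) (v : ℝ → ℝ) : Prop :=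
  IsMonotoneFront p q f c v ∧ ∀ z, 0 < deriv v z

/-- The explicit upper bound `c₊`, as a function of `p`, `q` and `L₊`. -/
noncomputable def cPlus (p q L : ℝ) : ℝ :=
  if L ≤ p + q - 2 then
    L ^ (1 / q.conjExponent) * q / (q - 1) * (p + q - 2) ^ (1 / q)
  else if L ≤ (p - 1) / (q - 1) * (p + q - 2) then
    p * (p + q - 2) / (q - 1)
  else
    L ^ (1 / p.conjExponent) * p / ((q - 1) ^ (1 / p) * (p - 1) ^ ((p - 1) / p)) *
      (p + q - 2) ^ (1 / p)

/-! Where a front `v` is increasing, its flux `|v'|^(p-2) v' + |v'|^(q-2) v'` is a function `P` of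
the state `u = v`. With `Ψ` the inverse of the flux function, the equation becomes the singular
first order problem `P' = c - f(u) / Ψ(P)`, `P > 0` on `(0,1)`, `P(0) = P(1) = 0`.

The backward problem from `P(1) = 0` always has a solution for `c ≥ 0` (`exists_isProfile`). In
terms of the energy `y = ∫₀^P Ψ` it reads `y' = c R(y) - f` with `R` continuous and increasing, which
is dissipative backwards in `u`, although `R` is not Lipschitz at `0`; solutions are limits of those
for Lipschitz approximations of `R` (`exists_backward_solution`). The speed `c` is admissible exactly
when `P(0) = 0`:
* from a profile with `P(0) = 0`, the front solves `v' = Ψ(P(v))`, by separation of variables, and is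
  continued by the constants `0` and `1` if it reaches them (`IsProfile.exists_isMonotoneFront`);
* conversely the energies of the flux of a front and of the profile along the front differ by a
  `D` with `(D²)' ≥ 0` and `D → 0` at `+∞`, so they agree (`IsMonotoneFront.flux_eq_profile`), and
  boundedness of `v` forces `P(0) = 0` (`IsMonotoneFront.profile_map_zero`).

By comparison, `P` decreases with `c`, and `P(0)` depends on `c` in a nonexpansive way, so the
admissible speeds form a closed half line (`exists_critical_speed`). The upper bound comes from the
supersolution belonging to `v' = β v^(1/(q-1))` (`IsProfile.le_power`) with the best `β`
(`exists_slope_le_cPlus`). The lower bound is trivial for `q > 2`, where `L₀ = 0`, and for `q = 2` it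
is the linear bound `c² ≥ 4 L₀` (`IsProfile.four_mul_le_sq`).

A front is strict as soon as its slope `Ψ(P(u))` is `O(u)` at `0` and `O(1 - u)` at `1`
(`IsProfile.exists_isStrictFront`). The second bound always holds (`IsProfile.slope_le_one_sub`). The
first is immediate for `q = 2`; for `q > 2` it holds once `P(u) ≤ c' u` for some `c' < c`
(`IsProfile.exists_slope_le_mul`), which follows by comparison with the critical profile if `c` is
larger than the critical speed, and with the explicit supersolution if `c = c₊`. -/

/-! ### Comparison and existence for dissipative backward problems -/

/-- A function that is nonnegative at the right end of an interval and does not increase while it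
is negative is nonnegative: a negative value would persist up to the right end. -/
theorem nonneg_of_deriv_nonpos_of_neg {D D' : ℝ → ℝ} {a b : ℝ} (hD : ContinuousOn D (Icc a b))
    (hD' : ∀ u ∈ Ioo a b, HasDerivAt D (D' u) u) (hb : 0 ≤ D b)
    (hneg : ∀ u ∈ Ioo a b, D u < 0 → D' u ≤ 0) : ∀ u ∈ Icc a b, 0 ≤ D u := by
  intro u hu
  by_contra! hlt
  -- `t` is the first point after `u` where `D` is nonnegative again
  set S : Set ℝ := Icc u b ∩ D ⁻¹' Ici 0 with hS
  have hcont : ContinuousOn D (Icc u b) := hD.mono (Icc_subset_Icc_left hu.1)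
  have hSc : IsClosed S := hcont.preimage_isClosed_of_isClosed isClosed_Icc isClosed_Ici
  have hSn : S.Nonempty := ⟨b, ⟨hu.2, le_rfl⟩, hb⟩
  have hSb : BddBelow S := ⟨u, fun x hx => hx.1.1⟩
  have ht : sInf S ∈ S := hSc.csInf_mem hSn hSb
  set t := sInf S
  have hanti : AntitoneOn D (Icc u t) := by
    refine antitoneOn_of_hasDerivWithinAt_nonpos (f' := D') (convex_Icc u t)
      (hcont.mono (Icc_subset_Icc_right ht.1.2)) ?_ ?_
    · intro x hx
      rw [interior_Icc] at hx
      exact (hD' x ⟨hu.1.trans_lt hx.1, hx.2.trans_le ht.1.2⟩).hasDerivWithinAt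
    · intro x hx
      rw [interior_Icc] at hx
      refine hneg x ⟨hu.1.trans_lt hx.1, hx.2.trans_le ht.1.2⟩ ?_
      by_contra! h0
      exact absurd (csInf_le hSb (⟨⟨hx.1.le, hx.2.le.trans ht.1.2⟩, h0⟩ : x ∈ S)) (not_le.2 hx.2)
  have h1 := hanti ⟨le_rfl, ht.1.1⟩ ⟨ht.1.1, le_rfl⟩ ht.1.1
  have h2 : 0 ≤ D t := ht.2
  linarith

/-- A strictly increasing continuous function from `[0,∞)` onto itself has a continuous monotone
inverse, here extended by zero to the negative half line. -/
theorem exists_continuous_inverse {g : ℝ → ℝ} (hc : ContinuousOn g (Ici 0))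
    (hm : StrictMonoOn g (Ici 0)) (h0 : g 0 = 0) (ht : Tendsto g atTop atTop) :
    ∃ h : ℝ → ℝ, Continuous h ∧ Monotone h ∧ (∀ y ≤ 0, h y = 0) ∧ (∀ y, 0 ≤ h y) ∧
      (∀ s, 0 ≤ s → h (g s) = s) ∧ ∀ y, 0 ≤ y → g (h y) = y := by
  -- extend `g` to an increasing bijection of the line that is the identity on the negatives
  set e : ℝ → ℝ := fun s => g (max s 0) + min s 0 with he
  have hec : Continuous e := by
    refine Continuous.add ?_ (by fun_prop)
    exact hc.comp_continuous (by fun_prop) (fun s => mem_Ici.2 (le_max_right _ _))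
  have hepos : ∀ s, 0 ≤ s → e s = g s := fun s hs => by simp [he, hs]
  have heneg : ∀ s, s ≤ 0 → e s = s := fun s hs => by simp [he, hs, h0]
  have hem : StrictMono e := by
    intro s t hst
    have hgle : g (max s 0) ≤ g (max t 0) :=
      hm.monotoneOn (mem_Ici.2 (le_max_right _ _)) (mem_Ici.2 (le_max_right _ _))
        (max_le_max_right _ hst.le)
    rcases le_or_gt 0 s with hs | hs
    · rw [hepos s hs, hepos t (hs.trans hst.le)]
      exact hm hs (hs.trans hst.le) hst
    · have : min s 0 < min t 0 := by
        rw [min_eq_left hs.le]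
        exact lt_min hst hs
      simp only [he]
      linarith
  have hesurj : Function.Surjective e := by
    refine hec.surjective ?_ ?_
    · exact ht.congr' ((eventually_ge_atTop 0).mono fun s hs => (hepos s hs).symm)
    · exact tendsto_id.congr' ((eventually_le_atBot 0).mono fun s hs => (heneg s hs).symm)
  set i := hem.orderIsoOfSurjective e hesurj with hi
  have hie : ∀ s, i s = e s := fun s => rfl
  refine ⟨fun y => i.symm (max y 0), i.symm.continuous.comp (by fun_prop), ?_, ?_, ?_, ?_, ?_⟩
  · exact fun a b hab => i.symm.monotone (max_le_max_right _ hab)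
  · intro y hy
    show i.symm (max y 0) = 0
    rw [max_eq_right hy, OrderIso.symm_apply_eq, hie, heneg 0 le_rfl]
  · intro y
    show 0 ≤ i.symm (max y 0)
    rw [OrderIso.le_symm_apply, hie, heneg 0 le_rfl]
    exact le_max_right _ _
  · intro s hs
    have : 0 ≤ g s := by
      rw [← h0]
      exact hm.monotoneOn self_mem_Ici hs hs
    show i.symm (max (g s) 0) = s
    rw [max_eq_left this, OrderIso.symm_apply_eq, hie, hepos s hs]
  · intro y hy
    show g (i.symm (max y 0)) = y
    have h1 : 0 ≤ i.symm y := by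
      rw [OrderIso.le_symm_apply, hie, heneg 0 le_rfl]
      exact hy
    rw [max_eq_left hy, ← hepos _ h1, ← hie, OrderIso.apply_symm_apply]

/-- A continuous function that is constant outside `[0,M]` is a uniform limit of Lipschitz
functions. -/
theorem exists_lipschitz_near {R : ℝ → ℝ} (hR : Continuous R) {M : ℝ} (hM : 0 ≤ M)
    (hRM : ∀ y, R y = R (projIcc 0 M hM y)) {ε : ℝ} (hε : 0 < ε) :
    ∃ (g : ℝ → ℝ) (K : NNReal), LipschitzWith K g ∧ ∀ y, |g y - R y| ≤ ε := by
  obtain ⟨P, hP⟩ := exists_polynomial_near_of_continuousOn 0 M R hR.continuousOn ε hε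
  have hcd : ContDiffOn ℝ 1 (fun x => P.eval x) (Icc 0 M) :=
    (show ContDiff ℝ 1 fun x => P.eval x by
      simpa using P.contDiff_aeval (𝕜 := ℝ) 1).contDiffOn
  obtain ⟨K, hK⟩ := hcd.exists_lipschitzOnWith one_ne_zero (convex_Icc 0 M) isCompact_Icc
  refine ⟨fun y => P.eval (projIcc 0 M hM y : ℝ), K, ?_, ?_⟩
  · intro x y
    refine (hK (projIcc 0 M hM x).2 (projIcc 0 M hM y).2).trans ?_
    gcongr
    have h1 := (LipschitzWith.projIcc hM) x y
    rwa [ENNReal.coe_one, one_mul] at h1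
  · intro y
    rw [hRM y]
    exact (hP _ (projIcc 0 M hM y).2).le

/-- Backward solvability for a globally Lipschitz nonlinearity. -/
theorem exists_backward_solution_of_lipschitz {g F : ℝ → ℝ} {K : NNReal} (hg : LipschitzWith K g)
    {B C c a b : ℝ} (hB : ∀ y, |g y| ≤ B) (hF : Continuous F) (hC : ∀ u ∈ Icc a b, |F u| ≤ C)
    (hab : a ≤ b) :
    ∃ y : ℝ → ℝ, y b = 0 ∧ ContinuousOn y (Icc a b) ∧
      ∀ u ∈ Ioo a b, HasDerivAt y (c * g (y u) - F u) u := by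
  have hB0 : 0 ≤ B := (abs_nonneg _).trans (hB 0)
  have hC0 : 0 ≤ C := (abs_nonneg _).trans (hC a ⟨le_rfl, hab⟩)
  set L : NNReal := ⟨|c| * B + C, by positivity⟩ with hL
  set A : NNReal := L * ⟨b - a, sub_nonneg.2 hab⟩ with hA
  have hPL : IsPicardLindelof (fun u y => c * g y - F u) (⟨b, hab, le_rfl⟩ : Icc a b) 0 A 0 L
      (‖c‖₊ * K) := by
    refine ⟨?_, ?_, ?_, ?_⟩
    · intro t _
      refine (LipschitzWith.of_dist_le_mul fun x y => ?_).lipschitzOnWith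
      have := hg.dist_le_mul x y
      rw [Real.dist_eq] at *
      rw [show c * g x - F t - (c * g y - F t) = c * (g x - g y) by ring, abs_mul]
      push_cast
      rw [Real.norm_eq_abs, mul_assoc]
      exact mul_le_mul_of_nonneg_left this (abs_nonneg _)
    · intro x _
      fun_prop
    · intro t ht x _
      calc ‖c * g x - F t‖ ≤ |c * g x| + |F t| := abs_sub _ _
        _ ≤ |c| * B + C := by
          rw [abs_mul]
          exact add_le_add (mul_le_mul_of_nonneg_left (hB x) (abs_nonneg _)) (hC t ht)
    · simp only [sub_self, NNReal.coe_zero, sub_zero]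
      rw [max_eq_right (sub_nonneg.2 hab)]
      exact le_rfl
  obtain ⟨y, hy0, hy⟩ := hPL.exists_eq_forall_mem_Icc_hasDerivWithinAt₀
  refine ⟨y, hy0, fun u hu => (hy u hu).continuousWithinAt, fun u hu => ?_⟩
  exact (hy u (Ioo_subset_Icc_self hu)).hasDerivAt (Icc_mem_nhds hu.1 hu.2)

/-- Backward solvability of `y' = c R(y) - F` for monotone `R` that need not be Lipschitz.
Monotonicity makes the backward problem dissipative, so solutions for Lipschitz approximations
of `R` form a uniformly Cauchy sequence. -/
theorem exists_backward_solution {R F : ℝ → ℝ} (hR : Continuous R) (hmono : Monotone R)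
    {M : ℝ} (hM : 0 ≤ M) (hRM : ∀ y, R y = R (projIcc 0 M hM y)) (hF : Continuous F)
    {c : ℝ} (hc : 0 ≤ c) {a b : ℝ} (hab : a ≤ b) :
    ∃ y : ℝ → ℝ, y b = 0 ∧ ContinuousOn y (Icc a b) ∧
      ∀ u ∈ Ioo a b, HasDerivAt y (c * R (y u) - F u) u := by
  obtain ⟨C, hC⟩ := isCompact_Icc.exists_bound_of_continuousOn (hF.continuousOn (s := Icc a b))
  obtain ⟨B, hB⟩ := isCompact_Icc.exists_bound_of_continuousOn (hR.continuousOn (s := Icc 0 M))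
  have hBR : ∀ y, |R y| ≤ B := fun y => by
    rw [hRM y]
    exact hB _ (projIcc 0 M hM y).2
  have hε : ∀ n : ℕ, (0 : ℝ) < 1 / ((n : ℝ) + 1) := fun n => Nat.one_div_pos_of_nat
  choose g K hgK hgR using fun n : ℕ => exists_lipschitz_near hR hM hRM (hε n)
  have hgB : ∀ n y, |g n y| ≤ B + 1 / ((n : ℝ) + 1) := fun n y => by
    have h1 := hgR n y
    have h2 := hBR y
    rw [abs_le] at *
    constructor <;> linarith
  choose y hyb hyc hyd using fun n : ℕ =>
    exists_backward_solution_of_lipschitz (c := c) (hgK n) (hgB n) hF hC hab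
  have hone : ∀ n m, ∀ u ∈ Icc a b,
      y n u - y m u ≤ (b - a) * c * (1 / ((n : ℝ) + 1) + 1 / ((m : ℝ) + 1)) := by
    intro n m u hu
    set η := 1 / ((n : ℝ) + 1) + 1 / ((m : ℝ) + 1) with hη
    have hη0 : 0 ≤ η := add_nonneg (hε n).le (hε m).le
    have key := nonneg_of_deriv_nonpos_of_neg (D := fun u => (b - u) * (c * η) - (y n u - y m u))
      (D' := fun u => (-1) * (c * η) - ((c * g n (y n u) - F u) - (c * g m (y m u) - F u)))
      (a := a) (b := b) ?_ ?_ ?_ ?_ u hu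
    · have : (b - u) * (c * η) ≤ (b - a) * (c * η) :=
        mul_le_mul_of_nonneg_right (by linarith [hu.1]) (mul_nonneg hc hη0)
      have key' : 0 ≤ (b - u) * (c * η) - (y n u - y m u) := key
      rw [mul_assoc]
      linarith
    · exact (by fun_prop : Continuous fun u : ℝ => (b - u) * (c * η)).continuousOn.sub
        ((hyc n).sub (hyc m))
    · intro x hx
      exact (((hasDerivAt_id x).const_sub b).mul_const _).sub ((hyd n x hx).sub (hyd m x hx))
    · simp [hyb]
    · intro x hx hlt
      have hpos : 0 ≤ (b - x) * (c * η) :=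
        mul_nonneg (by linarith [hx.2]) (mul_nonneg hc hη0)
      have h1 : R (y m x) ≤ R (y n x) := hmono (by linarith)
      have h2 := abs_le.1 (hgR n (y n x))
      have h3 := abs_le.1 (hgR m (y m x))
      have h4 : 0 ≤ c * (g n (y n x) - g m (y m x) + η) :=
        mul_nonneg hc (by rw [hη]; linarith [h2.1, h3.2])
      linarith
  have hcauchy : UniformCauchySeqOn y atTop (Icc a b) := by
    rw [Metric.uniformCauchySeqOn_iff]
    intro ε hε0
    have hlim : Tendsto (fun n : ℕ => (b - a) * c * (1 / ((n : ℝ) + 1) + 1 / ((n : ℝ) + 1)))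
        atTop (𝓝 0) := by
      simpa using (tendsto_one_div_add_atTop_nhds_zero_nat.add
        (tendsto_one_div_add_atTop_nhds_zero_nat (𝕜 := ℝ))).const_mul ((b - a) * c)
    obtain ⟨N, hN⟩ := (hlim.eventually (gt_mem_nhds hε0)).exists
    refine ⟨N, fun m hm n hn u hu => ?_⟩
    have hle : ∀ k ≥ N, 1 / ((k : ℝ) + 1) ≤ 1 / ((N : ℝ) + 1) := fun k hk =>
      Nat.one_div_le_one_div hk
    have hba : 0 ≤ (b - a) * c := mul_nonneg (sub_nonneg.2 hab) hc
    have h5 : ∀ i j, N ≤ i → N ≤ j → y i u - y j u < ε := fun i j hi hj =>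
      ((hone i j u hu).trans
        (mul_le_mul_of_nonneg_left (add_le_add (hle i hi) (hle j hj)) hba)).trans_lt hN
    rw [Real.dist_eq, abs_lt]
    constructor <;> linarith [h5 m n hm hn, h5 n m hn hm]
  have hpt : ∀ u ∈ Icc a b, ∃ l, Tendsto (fun n => y n u) atTop (𝓝 l) := fun u hu =>
    cauchySeq_tendsto_of_complete (hcauchy.cauchySeq hu)
  choose! Y hY using hpt
  have hunif : TendstoUniformlyOn y Y atTop (Icc a b) := hcauchy.tendstoUniformlyOn_of_tendsto hY
  have hRu : UniformContinuous R := by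
    have h1 : UniformContinuous fun x : Icc 0 M => R x :=
      CompactSpace.uniformContinuous_of_continuous (by fun_prop)
    have h2 := h1.comp (LipschitzWith.projIcc hM).uniformContinuous
    rwa [show R = (fun x : Icc 0 M => R x) ∘ projIcc 0 M hM from funext hRM]
  refine ⟨Y, ?_, hunif.continuousOn (Eventually.of_forall hyc).frequently, ?_⟩
  · refine tendsto_nhds_unique (hY b ⟨hab, le_rfl⟩) ?_
    simp [hyb]
  · intro u hu
    refine hasDerivAt_of_tendstoUniformlyOn (f := y) (l := atTop)
      (f' := fun n u => c * g n (y n u) - F u) (g' := fun u => c * R (Y u) - F u)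
      isOpen_Ioo ?_ (Eventually.of_forall hyd) (fun x hx => hY x (Ioo_subset_Icc_self hx)) hu
    rw [Metric.tendstoUniformlyOn_iff]
    intro ε hε0
    set δ := ε / (2 * (c + 1)) with hδ
    have hδ0 : 0 < δ := by positivity
    have h1 := Metric.tendstoUniformlyOn_iff.1
      (hRu.comp_tendstoUniformlyOn (hunif.mono Ioo_subset_Icc_self)) δ hδ0
    have h2 : ∀ᶠ n : ℕ in atTop, 1 / ((n : ℝ) + 1) < δ :=
      tendsto_one_div_add_atTop_nhds_zero_nat.eventually (gt_mem_nhds hδ0)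
    filter_upwards [h1, h2] with n hn1 hn2 x hx
    have h3 := hn1 x hx
    have h4 := hgR n (y n x)
    simp only [Function.comp, Real.dist_eq] at h3 ⊢
    rw [show c * R (Y x) - F x - (c * g n (y n x) - F x)
      = c * ((R (Y x) - R (y n x)) - (g n (y n x) - R (y n x))) by ring, abs_mul, abs_of_nonneg hc]
    have h5 := abs_sub (R (Y x) - R (y n x)) (g n (y n x) - R (y n x))
    have h6 : |(R (Y x) - R (y n x)) - (g n (y n x) - R (y n x))| ≤ 2 * δ := by linarith
    calc c * _ ≤ c * (2 * δ) := mul_le_mul_of_nonneg_left h6 hc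
      _ < (c + 1) * (2 * δ) := by linarith
      _ = ε := by rw [hδ]; field_simp

/-! ### The inverse flux and its primitive -/

/-- `Ψ` inverts the flux `s ↦ |s|^(p-2) s + |s|^(q-2) s` on the half line `[0,∞)`, and is extended
by zero to negative arguments. -/
structure IsFluxInverse (p q : ℝ) (Ψ : ℝ → ℝ) : Prop where
  continuous : Continuous Ψ
  monotone : Monotone Ψ
  eq_zero : ∀ y ≤ 0, Ψ y = 0
  nonneg : ∀ y, 0 ≤ Ψ y
  left_inv : ∀ s, 0 ≤ s → Ψ (pqFlux p q s) = s
  right_inv : ∀ y, 0 ≤ y → pqFlux p q (Ψ y) = y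

theorem pqFlux_of_nonneg {p q s : ℝ} (hq : 2 ≤ q) (hqp : q < p) (hs : 0 ≤ s) :
    pqFlux p q s = s ^ (p - 1) + s ^ (q - 1) := by
  rw [pqFlux, abs_of_nonneg hs]
  rcases hs.eq_or_lt with rfl | hs
  · rw [Real.zero_rpow (by linarith : p - 1 ≠ 0), Real.zero_rpow (by linarith : q - 1 ≠ 0)]
    simp
  · rw [show p - 1 = p - 2 + 1 by ring, show q - 1 = q - 2 + 1 by ring,
      Real.rpow_add_one hs.ne', Real.rpow_add_one hs.ne']

theorem pqFlux_zero (p q : ℝ) : pqFlux p q 0 = 0 := by simp [pqFlux]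

theorem pqFlux_nonneg {p q s : ℝ} (hs : 0 ≤ s) : 0 ≤ pqFlux p q s := by
  rw [pqFlux]
  positivity

theorem strictMonoOn_pqFlux {p q : ℝ} (hq : 2 ≤ q) (hqp : q < p) :
    StrictMonoOn (pqFlux p q) (Ici 0) := by
  intro s hs t ht hst
  rw [pqFlux_of_nonneg hq hqp hs, pqFlux_of_nonneg hq hqp ht]
  exact add_lt_add (Real.rpow_lt_rpow hs hst (by linarith)) (Real.rpow_lt_rpow hs hst (by linarith))

theorem exists_isFluxInverse {p q : ℝ} (hq : 2 ≤ q) (hqp : q < p) :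
    ∃ Ψ, IsFluxInverse p q Ψ := by
  have hcont : ContinuousOn (pqFlux p q) (Ici 0) := by
    refine ContinuousOn.congr (f := fun s : ℝ => s ^ (p - 1) + s ^ (q - 1)) ?_
      fun s hs => pqFlux_of_nonneg hq hqp hs
    exact ((Real.continuous_rpow_const (by linarith)).add
      (Real.continuous_rpow_const (by linarith))).continuousOn
  have htop : Tendsto (pqFlux p q) atTop atTop := by
    refine ((tendsto_rpow_atTop (by linarith : 0 < p - 1)).atTop_add_atTop
      (tendsto_rpow_atTop (by linarith : 0 < q - 1))).congr' ?_
    filter_upwards [eventually_ge_atTop 0] with s hs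
    exact (pqFlux_of_nonneg hq hqp hs).symm
  obtain ⟨Ψ, h1, h2, h3, h4, h5, h6⟩ := exists_continuous_inverse hcont
    (strictMonoOn_pqFlux hq hqp) (pqFlux_zero p q) htop
  exact ⟨Ψ, h1, h2, h3, h4, h5, h6⟩

namespace IsFluxInverse

variable {p q : ℝ} {Ψ : ℝ → ℝ}

theorem pos (h : IsFluxInverse p q Ψ) {y : ℝ} (hy : 0 < y) : 0 < Ψ y := by
  refine (h.nonneg y).lt_of_ne fun h0 => hy.ne ?_
  rw [← h.right_inv y hy.le, ← h0, pqFlux_zero]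

end IsFluxInverse

/-- The primitive `∫₀^P Ψ` of the inverse flux; along a front with flux `P` it is the kinetic part
of the first integral of the equation. -/
noncomputable def fluxEnergy (Ψ : ℝ → ℝ) (P : ℝ) : ℝ := ∫ x in (0 : ℝ)..P, Ψ x

namespace IsFluxInverse

variable {p q : ℝ} {Ψ : ℝ → ℝ}

theorem hasDerivAt_fluxEnergy (h : IsFluxInverse p q Ψ) (P : ℝ) :
    HasDerivAt (fluxEnergy Ψ) (Ψ P) P :=
  intervalIntegral.integral_hasDerivAt_right (h.continuous.intervalIntegrable _ _)
    h.continuous.aestronglyMeasurable.stronglyMeasurableAtFilter h.continuous.continuousAt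

theorem fluxEnergy_zero (Ψ : ℝ → ℝ) : fluxEnergy Ψ 0 = 0 := by simp [fluxEnergy]

theorem continuous_fluxEnergy (h : IsFluxInverse p q Ψ) : Continuous (fluxEnergy Ψ) :=
  continuous_iff_continuousAt.2 fun P => (h.hasDerivAt_fluxEnergy P).continuousAt

theorem strictMonoOn_fluxEnergy (h : IsFluxInverse p q Ψ) :
    StrictMonoOn (fluxEnergy Ψ) (Ici 0) := by
  refine strictMonoOn_of_deriv_pos (convex_Ici 0) h.continuous_fluxEnergy.continuousOn ?_
  intro x hx
  rw [interior_Ici] at hx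
  rw [(h.hasDerivAt_fluxEnergy x).deriv]
  exact h.pos hx

theorem tendsto_fluxEnergy (h : IsFluxInverse p q Ψ) : Tendsto (fluxEnergy Ψ) atTop atTop := by
  have hmono : MonotoneOn (fun P => fluxEnergy Ψ P - Ψ 1 * P) (Ici 1) := by
    refine monotoneOn_of_hasDerivWithinAt_nonneg (f' := fun P => Ψ P - Ψ 1 * 1) (convex_Ici 1)
      (h.continuous_fluxEnergy.sub (by fun_prop)).continuousOn ?_ ?_
    · intro x _
      exact ((h.hasDerivAt_fluxEnergy x).sub ((hasDerivAt_id x).const_mul _)).hasDerivWithinAt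
    · intro x hx
      rw [interior_Ici] at hx
      have := h.monotone (le_of_lt hx)
      linarith
  have hlin : Tendsto (fun P : ℝ => Ψ 1 * P + (fluxEnergy Ψ 1 - Ψ 1 * 1)) atTop atTop :=
    tendsto_atTop_add_const_right _ _ (tendsto_id.const_mul_atTop (h.pos one_pos))
  refine tendsto_atTop_mono' _ ?_ hlin
  filter_upwards [eventually_ge_atTop 1] with P hP
  have := hmono self_mem_Ici hP hP
  simp only at this
  linarith

end IsFluxInverse

/-! ### Profiles: the flux as a function of the state -/

/-- `P` is the profile of speed `c`: where `v` is a front with `v' > 0`, its flux is a function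
`P(v)` solving `P' = c - f / Ψ(P)` on `(0,1)`. The equation is singular where `P` vanishes, so the
regular equation for the energy `∫₀^P Ψ`, which holds up to the endpoints, is recorded as well.
Only the boundary condition at `1` is imposed; a front also needs `P 0 = 0`. -/
structure IsProfile (Ψ f : ℝ → ℝ) (c : ℝ) (P : ℝ → ℝ) : Prop where
  continuousOn : ContinuousOn P (Icc 0 1)
  pos : ∀ u ∈ Ioo (0 : ℝ) 1, 0 < P u
  zero_nonneg : 0 ≤ P 0
  map_one : P 1 = 0
  hasDerivAt : ∀ u ∈ Ioo (0 : ℝ) 1, HasDerivAt P (c - f u / Ψ (P u)) u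
  hasDerivWithinAt_energy : ∀ u ∈ Icc (0 : ℝ) 1,
    HasDerivWithinAt (fun u => fluxEnergy Ψ (P u)) (c * Ψ (P u) - f u) (Icc 0 1) u

theorem IsFisherType.nonneg {f : ℝ → ℝ} (hf : IsFisherType f) : ∀ u ∈ Icc (0 : ℝ) 1, 0 ≤ f u := by
  intro u hu
  rcases hu.1.eq_or_lt with rfl | h0
  · exact hf.map_zero.ge
  rcases hu.2.eq_or_lt with rfl | h1
  · exact hf.map_one.ge
  exact (hf.pos u ⟨h0, h1⟩).le

/-- The profile is recovered from its energy `y`, which solves the backward problem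
`y' = c Ψ(K y) - f`, `y 1 = 0`, where `K` inverts the primitive of `Ψ`. -/
theorem exists_isProfile {p q : ℝ} {Ψ f : ℝ → ℝ} (hΨ : IsFluxInverse p q Ψ) (hf : IsFisherType f)
    {c : ℝ} (hc : 0 ≤ c) : ∃ P, IsProfile Ψ f c P := by
  obtain ⟨K, hKc, hKm, hK0, hKn, hKl, hKr⟩ := exists_continuous_inverse
    hΨ.continuous_fluxEnergy.continuousOn hΨ.strictMonoOn_fluxEnergy
    (IsFluxInverse.fluxEnergy_zero Ψ) hΨ.tendsto_fluxEnergy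
  have hfc : ContinuousOn f (Icc 0 1) := hf.contDiffOn.continuousOn
  have hf0 := hf.nonneg
  obtain ⟨C, hC⟩ := isCompact_Icc.exists_bound_of_continuousOn hfc
  have hC0 : 0 ≤ C := (norm_nonneg _).trans (hC 0 ⟨le_rfl, zero_le_one⟩)
  -- the reaction is clamped to its boundary values so that the problem lives on a larger interval
  set F : ℝ → ℝ := fun u => f (projIcc 0 1 zero_le_one u) with hF
  have hFc : Continuous F := (continuousOn_iff_continuous_domRestrict.1 hfc).comp continuous_projIcc
  have hFf : ∀ u ∈ Icc (0 : ℝ) 1, F u = f u := fun u hu => by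
    simp only [hF]
    rw [projIcc_of_mem _ hu]
  have hF0 : ∀ u, 0 ≤ F u := fun u => hf0 _ (projIcc 0 1 zero_le_one u).2
  have hFC : ∀ u, F u ≤ C := fun u => (le_abs_self _).trans (hC _ (projIcc 0 1 zero_le_one u).2)
  have hF1 : ∀ u, 1 ≤ u → F u = 0 := fun u hu => by
    simp only [hF]
    rw [projIcc_of_right_le _ hu]
    exact hf.map_one
  have hM : 0 ≤ 3 * C := by positivity
  set R : ℝ → ℝ := fun y => Ψ (K (projIcc 0 (3 * C) hM y)) with hR
  have hRnn : ∀ y, 0 ≤ R y := fun y => hΨ.nonneg _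
  have hR0 : ∀ y ≤ 0, R y = 0 := fun y hy => by
    simp only [hR]
    rw [projIcc_of_le_left _ hy]
    exact hΨ.eq_zero _ (hK0 0 le_rfl).le
  obtain ⟨y, hy2, hyc, hyd⟩ := exists_backward_solution (R := R) (F := F) (M := 3 * C)
    (hΨ.continuous.comp (hKc.comp (continuous_subtype_val.comp continuous_projIcc)))
    (fun a b hab => hΨ.monotone (hKm (monotone_projIcc hM hab))) hM
    (fun y => by simp only [hR, projIcc_val]) hFc hc (by norm_num : (-1 : ℝ) ≤ 2)
  have hynn : ∀ u ∈ Icc (-1 : ℝ) 2, 0 ≤ y u := by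
    refine nonneg_of_deriv_nonpos_of_neg hyc hyd hy2.ge fun u _ hneg => ?_
    rw [hR0 _ hneg.le]
    linarith [hF0 u]
  have hyle : ∀ u ∈ Icc (-1 : ℝ) 2, y u ≤ 3 * C := by
    intro u hu
    have key := nonneg_of_deriv_nonpos_of_neg (D := fun u => (2 - u) * C - y u)
      (D' := fun u => (-1) * C - (c * R (y u) - F u)) (a := -1) (b := 2)
      ((by fun_prop : Continuous fun u : ℝ => (2 - u) * C).continuousOn.sub hyc)
      (fun x hx => (((hasDerivAt_id x).const_sub 2).mul_const C).sub (hyd x hx))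
      (by simp [hy2]) (fun x _ _ => by nlinarith [mul_nonneg hc (hRnn (y x)), hFC x]) u hu
    nlinarith [mul_nonneg (by linarith [hu.1] : 0 ≤ u + 1) hC0]
  have hy1 : y 1 = 0 := by
    refine le_antisymm ?_ (hynn 1 (by norm_num))
    have key := nonneg_of_deriv_nonpos_of_neg (D := fun u => - y u)
      (D' := fun u => -(c * R (y u) - F u)) (a := 1) (b := 2)
      (hyc.mono (Icc_subset_Icc_left (by norm_num))).neg
      (fun x hx => (hyd x ⟨by linarith [hx.1], hx.2⟩).neg) (by simp [hy2])
      (fun x hx _ => by rw [hF1 x hx.1.le]; linarith [mul_nonneg hc (hRnn (y x))]) 1 (by norm_num)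
    simpa using key
  have hsub : Icc (0 : ℝ) 1 ⊆ Ioo (-1) 2 := fun u hu => ⟨by linarith [hu.1], by linarith [hu.2]⟩
  have hRK : ∀ u ∈ Icc (0 : ℝ) 1, R (y u) = Ψ (K (y u)) := fun u hu => by
    have hu' := Ioo_subset_Icc_self (hsub hu)
    simp only [hR]
    rw [projIcc_of_mem _ ⟨hynn u hu', hyle u hu'⟩]
  have hyd' : ∀ u ∈ Icc (0 : ℝ) 1, HasDerivAt y (c * Ψ (K (y u)) - f u) u := fun u hu => by
    have := hyd u (hsub hu)
    rwa [hRK u hu, hFf u hu] at this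
  have hypos : ∀ u ∈ Ioo (0 : ℝ) 1, 0 < y u := by
    intro u hu
    refine (hynn u (Ioo_subset_Icc_self (hsub (Ioo_subset_Icc_self hu)))).lt_of_ne fun h0 => ?_
    -- at an interior zero, `y` has a minimum but slope `-f u < 0`
    have hmin : IsLocalMin y u := by
      filter_upwards [Icc_mem_nhds (by linarith [hu.1] : (-1 : ℝ) < u)
        (by linarith [hu.2] : u < 2)] with x hx
      rw [← h0]
      exact hynn x hx
    have h1 := hmin.hasDerivAt_eq_zero (hyd' u (Ioo_subset_Icc_self hu))
    rw [← h0, hK0 0 le_rfl, hΨ.eq_zero 0 le_rfl] at h1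
    linarith [hf.pos u hu]
  have hGK : ∀ u ∈ Icc (0 : ℝ) 1, fluxEnergy Ψ (K (y u)) = y u := fun u hu =>
    hKr _ (hynn u (Ioo_subset_Icc_self (hsub hu)))
  have hKpos : ∀ u ∈ Ioo (0 : ℝ) 1, 0 < K (y u) := by
    intro u hu
    refine (hKn _).lt_of_ne fun h0 => (hypos u hu).ne ?_
    rw [← hGK u (Ioo_subset_Icc_self hu), ← h0, IsFluxInverse.fluxEnergy_zero]
  refine ⟨fun u => K (y u), ?_, hKpos, hKn _, ?_, ?_, ?_⟩
  · exact hKc.comp_continuousOn (hyc.mono (hsub.trans Ioo_subset_Icc_self))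
  · show K (y 1) = 0
    rw [hy1, hK0 0 le_rfl]
  · intro u hu
    have hu' := Ioo_subset_Icc_self hu
    have hΨpos := hΨ.pos (hKpos u hu)
    have hK' : HasDerivAt K (Ψ (K (y u)))⁻¹ (y u) := by
      refine HasDerivAt.of_local_left_inverse hKc.continuousAt
        (hΨ.hasDerivAt_fluxEnergy _) hΨpos.ne' ?_
      filter_upwards [lt_mem_nhds (hypos u hu)] with x hx
      exact hKr x hx.le
    refine (hK'.comp u (hyd' u hu')).congr_deriv ?_
    field_simp
  · intro u hu
    exact ((hyd' u hu).hasDerivWithinAt).congr hGK (hGK u hu)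

/-! ### Comparison of profiles and the critical speed -/

namespace IsProfile

variable {p q : ℝ} {Ψ f : ℝ → ℝ}

theorem nonneg {c : ℝ} {P : ℝ → ℝ} (hP : IsProfile Ψ f c P) : ∀ u ∈ Icc (0 : ℝ) 1, 0 ≤ P u := by
  intro u hu
  rcases hu.1.eq_or_lt with rfl | h0
  · exact hP.zero_nonneg
  rcases hu.2.eq_or_lt with rfl | h1
  · exact hP.map_one.ge
  exact (hP.pos u ⟨h0, h1⟩).le

/-- A profile stays below any positive supersolution that dominates it at the right end. -/
theorem le_supersolution (hΨ : IsFluxInverse p q Ψ) (hf : IsFisherType f) {c : ℝ} {P : ℝ → ℝ}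
    (hP : IsProfile Ψ f c P) {b : ℝ} (hb : b ≤ 1) {Q Q' : ℝ → ℝ} (hQ : ContinuousOn Q (Icc 0 b))
    (hQ' : ∀ u ∈ Ioo 0 b, HasDerivAt Q (Q' u) u) (hpos : ∀ u ∈ Ioo 0 b, 0 < Q u)
    (hsup : ∀ u ∈ Ioo 0 b, Q' u ≤ c - f u / Ψ (Q u)) (hend : P b ≤ Q b) :
    ∀ u ∈ Icc 0 b, P u ≤ Q u := by
  intro u hu
  have hsub : ∀ x ∈ Ioo 0 b, x ∈ Ioo (0 : ℝ) 1 := fun x hx => ⟨hx.1, hx.2.trans_le hb⟩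
  refine sub_nonneg.1 (nonneg_of_deriv_nonpos_of_neg (D := fun u => Q u - P u)
    (D' := fun u => Q' u - (c - f u / Ψ (P u)))
    (hQ.sub (hP.continuousOn.mono (Icc_subset_Icc_right hb)))
    (fun x hx => (hQ' x hx).sub (hP.hasDerivAt x (hsub x hx))) (sub_nonneg.2 hend) ?_ u hu)
  intro x hx hlt
  have h1 : f x / Ψ (P x) ≤ f x / Ψ (Q x) :=
    div_le_div_of_nonneg_left (hf.pos x (hsub x hx)).le (hΨ.pos (hpos x hx))
      (hΨ.monotone (sub_neg.1 hlt).le)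
  linarith [hsup x hx]

theorem anti (hΨ : IsFluxInverse p q Ψ) (hf : IsFisherType f) {c d : ℝ} (hcd : c ≤ d)
    {P Q : ℝ → ℝ} (hP : IsProfile Ψ f c P) (hQ : IsProfile Ψ f d Q) :
    ∀ u ∈ Icc (0 : ℝ) 1, Q u ≤ P u :=
  hQ.le_supersolution hΨ hf le_rfl hP.continuousOn hP.hasDerivAt hP.pos
    (fun u _ => by linarith) (by rw [hP.map_one, hQ.map_one])

/-- The value at `0` is a nonexpansive function of the speed. -/
theorem map_zero_le_add (hΨ : IsFluxInverse p q Ψ) (hf : IsFisherType f) {c d : ℝ} (hcd : c ≤ d)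
    {P Q : ℝ → ℝ} (hP : IsProfile Ψ f c P) (hQ : IsProfile Ψ f d Q) : P 0 ≤ Q 0 + (d - c) := by
  have key := nonneg_of_deriv_nonpos_of_neg
    (D := fun u => Q u + (1 - u) * (d - c) - P u)
    (D' := fun u => (d - f u / Ψ (Q u)) + (-1) * (d - c) - (c - f u / Ψ (P u))) (a := 0) (b := 1)
    ((hQ.continuousOn.add (by fun_prop : Continuous fun u : ℝ => (1 - u) * (d - c)).continuousOn).sub
      hP.continuousOn)
    (fun x hx => ((hQ.hasDerivAt x hx).add
      (((hasDerivAt_id x).const_sub 1).mul_const _)).sub (hP.hasDerivAt x hx))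
    (by simp [hQ.map_one, hP.map_one]) ?_ 0 ⟨le_rfl, zero_le_one⟩
  · simp only [sub_zero, one_mul] at key
    linarith
  · intro x hx _
    have h1 : f x / Ψ (P x) ≤ f x / Ψ (Q x) :=
      div_le_div_of_nonneg_left (hf.pos x hx).le (hΨ.pos (hQ.pos x hx))
        (hΨ.monotone (anti hΨ hf hcd hP hQ x (Ioo_subset_Icc_self hx)))
    linarith

theorem le_mul (hΨ : IsFluxInverse p q Ψ) (hf : IsFisherType f) {c : ℝ} {P : ℝ → ℝ}
    (hP : IsProfile Ψ f c P) (h0 : P 0 = 0) : ∀ u ∈ Icc (0 : ℝ) 1, P u ≤ c * u := by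
  intro u hu
  have hanti : AntitoneOn (fun u => P u - c * u) (Icc 0 1) := by
    refine antitoneOn_of_hasDerivWithinAt_nonpos (f' := fun u => c - f u / Ψ (P u) - c * 1)
      (convex_Icc 0 1)
      (hP.continuousOn.sub (by fun_prop : Continuous fun u : ℝ => c * u).continuousOn) ?_ ?_
    · intro x hx
      rw [interior_Icc] at hx
      exact ((hP.hasDerivAt x hx).sub ((hasDerivAt_id x).const_mul c)).hasDerivWithinAt
    · intro x hx
      rw [interior_Icc] at hx
      have : 0 ≤ f x / Ψ (P x) := div_nonneg (hf.pos x hx).le (hΨ.nonneg _)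
      linarith
  have := hanti ⟨le_rfl, zero_le_one⟩ hu hu.1
  simp only [h0, mul_zero] at this
  linarith

theorem speed_pos (hΨ : IsFluxInverse p q Ψ) (hf : IsFisherType f) {c : ℝ} {P : ℝ → ℝ}
    (hP : IsProfile Ψ f c P) (h0 : P 0 = 0) : 0 < c := by
  have h1 := hP.le_mul hΨ hf h0 (1 / 2) (by norm_num)
  have h2 := hP.pos (1 / 2) (by norm_num)
  linarith

end IsProfile

/-- The speeds whose profile vanishes at `0` form a closed half line. -/
theorem exists_critical_speed {p q : ℝ} {Ψ f : ℝ → ℝ} (hΨ : IsFluxInverse p q Ψ)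
    (hf : IsFisherType f) {d : ℝ} {Q : ℝ → ℝ} (hQ : IsProfile Ψ f d Q) (hQ0 : Q 0 = 0) :
    ∃ cstar, 0 < cstar ∧ cstar ≤ d ∧
      ∀ c P, 0 ≤ c → IsProfile Ψ f c P → (P 0 = 0 ↔ cstar ≤ c) := by
  set S : Set ℝ := {c | 0 ≤ c ∧ ∃ P, IsProfile Ψ f c P ∧ P 0 = 0} with hS
  have hdS : d ∈ S := ⟨(hQ.speed_pos hΨ hf hQ0).le, Q, hQ, hQ0⟩
  have hbdd : BddBelow S := ⟨0, fun c hc => hc.1⟩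
  have hs0 : 0 ≤ sInf S := le_csInf ⟨d, hdS⟩ fun c hc => hc.1
  have hmem : ∀ c P, IsProfile Ψ f c P → sInf S ≤ c → P 0 = 0 := by
    intro c P hP hc
    refine le_antisymm (le_of_forall_pos_le_add fun ε hε => ?_) hP.zero_nonneg
    obtain ⟨e, ⟨he0, R, hR, hR0⟩, he⟩ := exists_lt_of_csInf_lt ⟨d, hdS⟩
      (show sInf S < sInf S + ε by linarith)
    rcases le_total e c with hec | hec
    · have := IsProfile.anti hΨ hf hec hR hP 0 ⟨le_rfl, zero_le_one⟩
      linarith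
    · have := IsProfile.map_zero_le_add hΨ hf hec hP hR
      linarith
  obtain ⟨P₀, hP₀⟩ := exists_isProfile hΨ hf hs0
  refine ⟨sInf S, hP₀.speed_pos hΨ hf (hmem _ _ hP₀ le_rfl), csInf_le hbdd hdS, ?_⟩
  exact fun c P hc hP => ⟨fun h => csInf_le hbdd ⟨hc, P, hP, h⟩, hmem c P hP⟩

/-! ### Bounds for the critical speed -/

/-- The curve `v' = β v^(1/(q-1))` gives an explicit supersolution. -/
theorem IsProfile.le_power {p q : ℝ} {Ψ f : ℝ → ℝ} (hq : 2 ≤ q) (hqp : q < p)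
    (hΨ : IsFluxInverse p q Ψ) (hf : IsFisherType f) {c : ℝ} {P : ℝ → ℝ} (hP : IsProfile Ψ f c P)
    {L β : ℝ} (hβ : 0 < β) (hL : ∀ u ∈ Ioo (0 : ℝ) 1, f u ≤ L * u ^ (1 / (q - 1)))
    (hc : (p - 1) / (q - 1) * β ^ (p - 1) + β ^ (q - 1) + L / β ≤ c) :
    ∀ u ∈ Icc (0 : ℝ) 1, P u ≤ β ^ (p - 1) * u ^ ((p - 1) / (q - 1)) + β ^ (q - 1) * u := by
  have hq1 : 0 < q - 1 := by linarith
  have hr : 1 ≤ (p - 1) / (q - 1) := by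
    rw [le_div_iff₀ hq1]
    linarith
  have hflux : ∀ u, 0 < u → pqFlux p q (β * u ^ (1 / (q - 1)))
      = β ^ (p - 1) * u ^ ((p - 1) / (q - 1)) + β ^ (q - 1) * u := by
    intro u hu
    rw [pqFlux_of_nonneg hq hqp (by positivity), Real.mul_rpow hβ.le (by positivity),
      Real.mul_rpow hβ.le (by positivity), ← Real.rpow_mul hu.le, ← Real.rpow_mul hu.le,
      one_div_mul_cancel hq1.ne', Real.rpow_one, one_div_mul_eq_div]
  refine hP.le_supersolution hΨ hf le_rfl
    (Q' := fun u => β ^ (p - 1) * ((p - 1) / (q - 1) * u ^ ((p - 1) / (q - 1) - 1))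
      + β ^ (q - 1) * 1) ?_ ?_ ?_ ?_ ?_
  · exact (((Real.continuous_rpow_const (by linarith)).const_mul _).add
      (by fun_prop)).continuousOn
  · intro u hu
    exact ((Real.hasDerivAt_rpow_const (Or.inl hu.1.ne')).const_mul _).add
      ((hasDerivAt_id u).const_mul _)
  · intro u hu
    have := hu.1
    positivity
  · intro u hu
    have hu0 := hu.1
    have hup : 0 < u ^ (1 / (q - 1)) := Real.rpow_pos_of_pos hu0 _
    rw [← hflux u hu0, hΨ.left_inv _ (by positivity)]
    have h1 : f u / (β * u ^ (1 / (q - 1))) ≤ L / β := by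
      rw [div_le_div_iff₀ (by positivity) hβ]
      nlinarith [hL u hu]
    have h2 : u ^ ((p - 1) / (q - 1) - 1) ≤ 1 :=
      Real.rpow_le_one hu0.le hu.2.le (by linarith)
    have h3 : β ^ (p - 1) * ((p - 1) / (q - 1) * u ^ ((p - 1) / (q - 1) - 1))
        ≤ (p - 1) / (q - 1) * β ^ (p - 1) := by
      have h4 : 0 ≤ (p - 1) / (q - 1) * β ^ (p - 1) := by positivity
      calc _ = (p - 1) / (q - 1) * β ^ (p - 1) * u ^ ((p - 1) / (q - 1) - 1) := by ring
        _ ≤ _ := mul_le_of_le_one_right h4 h2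
    linarith
  · rw [hP.map_one]
    positivity

/-- The optimal slope `β` in the power supersolution, in each regime of `L`. The powers of `β` are
replaced by the dominant one, which for `β ≤ 1` is `β^(q-1)` and for `β ≥ 1` is `β^(p-1)`. -/
theorem exists_slope_le_cPlus {p q L : ℝ} (hq : 2 ≤ q) (hqp : q < p) (hL : 0 < L) :
    ∃ β, 0 < β ∧ (p - 1) / (q - 1) * β ^ (p - 1) + β ^ (q - 1) + L / β ≤ cPlus p q L := by
  have hq0 : 0 < q := by linarith
  have hp0 : 0 < p := by linarith
  have hq1 : 0 < q - 1 := by linarith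
  have hp1 : 0 < p - 1 := by linarith
  have hm : 0 < p + q - 2 := by linarith
  rw [cPlus]
  split_ifs with h1 h2
  · -- `β^q = L / (p+q-2)`
    set x := L / (p + q - 2) with hx
    have hx0 : 0 < x := by positivity
    have hx1 : x ≤ 1 := (div_le_one hm).2 h1
    set β := x ^ (1 / q) with hβ
    have hβ0 : 0 < β := Real.rpow_pos_of_pos hx0 _
    have hβ1 : β ≤ 1 := Real.rpow_le_one hx0.le hx1 (by positivity)
    have hβq : β ^ q = x := by
      rw [hβ, ← Real.rpow_mul hx0.le, one_div_mul_cancel hq0.ne', Real.rpow_one]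
    have hpow : β ^ (q - 1) = x / β := by rw [Real.rpow_sub_one hβ0.ne', hβq]
    have hle : β ^ (p - 1) ≤ β ^ (q - 1) :=
      Real.rpow_le_rpow_of_exponent_ge hβ0 hβ1 (by linarith)
    have hLβ : L / β = L ^ (1 / q.conjExponent) * (p + q - 2) ^ (1 / q) := by
      have e1 : (1 : ℝ) / q.conjExponent = 1 - 1 / q := by
        rw [Real.conjExponent]
        field_simp
      rw [e1, Real.rpow_sub hL, Real.rpow_one, hβ, hx, Real.div_rpow hL.le hm.le]
      have := (Real.rpow_pos_of_pos hm (1 / q)).ne'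
      have := (Real.rpow_pos_of_pos hL (1 / q)).ne'
      field_simp
    refine ⟨β, hβ0, ?_⟩
    calc (p - 1) / (q - 1) * β ^ (p - 1) + β ^ (q - 1) + L / β
        ≤ (p - 1) / (q - 1) * β ^ (q - 1) + β ^ (q - 1) + L / β := by gcongr
      _ = L / β * (q / (q - 1)) := by
        rw [hpow, hx]
        field_simp
        ring
      _ = _ := by
        rw [hLβ]
        ring
  · refine ⟨1, one_pos, ?_⟩
    rw [Real.one_rpow, Real.one_rpow, div_one]
    have e : p * (p + q - 2) / (q - 1)
        = (p - 1) / (q - 1) + 1 + (p - 1) / (q - 1) * (p + q - 2) := by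
      field_simp
      ring
    rw [e]
    linarith
  · -- `β^p = L (q-1) / ((p-1)(p+q-2))`
    set y := (p - 1) / (q - 1) * (p + q - 2) with hy
    have hy0 : 0 < y := by positivity
    set x := L / y with hx
    have hx0 : 0 < x := by positivity
    have hx1 : 1 ≤ x := (one_le_div hy0).2 (not_le.1 h2).le
    set β := x ^ (1 / p) with hβ
    have hβ0 : 0 < β := Real.rpow_pos_of_pos hx0 _
    have hβ1 : 1 ≤ β := Real.one_le_rpow hx1 (by positivity)
    have hβp : β ^ p = x := by
      rw [hβ, ← Real.rpow_mul hx0.le, one_div_mul_cancel hp0.ne', Real.rpow_one]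
    have hpow : β ^ (p - 1) = x / β := by rw [Real.rpow_sub_one hβ0.ne', hβp]
    have hle : β ^ (q - 1) ≤ β ^ (p - 1) :=
      Real.rpow_le_rpow_of_exponent_le hβ1 (by linarith)
    have hLβ : L / β * (p / (p - 1)) = L ^ (1 / p.conjExponent) * p /
        ((q - 1) ^ (1 / p) * (p - 1) ^ ((p - 1) / p)) * (p + q - 2) ^ (1 / p) := by
      have e1 : (1 : ℝ) / p.conjExponent = 1 - 1 / p := by
        rw [Real.conjExponent]
        field_simp
      have e2 : (p - 1) / p = 1 - 1 / p := by field_simp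
      rw [e1, e2, Real.rpow_sub hL, Real.rpow_one, Real.rpow_sub hp1, Real.rpow_one, hβ, hx,
        Real.div_rpow hL.le hy0.le, hy, Real.mul_rpow (by positivity) hm.le,
        Real.div_rpow hp1.le hq1.le]
      have := (Real.rpow_pos_of_pos hm (1 / p)).ne'
      have := (Real.rpow_pos_of_pos hL (1 / p)).ne'
      have := (Real.rpow_pos_of_pos hp1 (1 / p)).ne'
      have := (Real.rpow_pos_of_pos hq1 (1 / p)).ne'
      field_simp
    refine ⟨β, hβ0, ?_⟩
    calc (p - 1) / (q - 1) * β ^ (p - 1) + β ^ (q - 1) + L / β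
        ≤ (p - 1) / (q - 1) * β ^ (p - 1) + β ^ (p - 1) + L / β := by gcongr
      _ = L / β * (p / (p - 1)) := by
        rw [hpow, hx, hy]
        field_simp
        ring
      _ = _ := hLβ

theorem IsFluxInverse.le_self {p Ψ} (hp : 2 < p) (hΨ : IsFluxInverse p 2 Ψ) {y : ℝ} (hy : 0 ≤ y) :
    Ψ y ≤ y := by
  have h1 := hΨ.right_inv y hy
  rw [pqFlux_of_nonneg le_rfl hp (hΨ.nonneg y), show (2 : ℝ) - 1 = 1 by norm_num,
    Real.rpow_one] at h1
  have := Real.rpow_nonneg (hΨ.nonneg y) (p - 1)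
  linarith

/-- If `f u ≥ m u` near `0` and the flux dominates the identity, an admissible speed satisfies
`c² ≥ 4 m`. Otherwise `h = P / u` would satisfy `u h' ≤ c - h - m / h ≤ -κ < 0`, hence grow like
`κ log (1 / u)` as `u → 0`, although `h ≤ c`. -/
theorem IsProfile.four_mul_le_sq {p q : ℝ} {Ψ f : ℝ → ℝ} (hΨ : IsFluxInverse p q Ψ)
    (hf : IsFisherType f) {c : ℝ} {P : ℝ → ℝ} (hP : IsProfile Ψ f c P) (h0 : P 0 = 0)
    (hle : ∀ y, 0 ≤ y → Ψ y ≤ y) {m δ : ℝ} (hδ : 0 < δ) (hδ1 : δ ≤ 1)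
    (hm : ∀ u ∈ Ioo 0 δ, m * u ≤ f u) : 4 * m ≤ c ^ 2 := by
  by_contra! hlt
  have hc : 0 < c := hP.speed_pos hΨ hf h0
  set κ := (m - c ^ 2 / 4) / c with hκ
  have hκ0 : 0 < κ := div_pos (by linarith) hc
  have hκc : κ * c = m - c ^ 2 / 4 := by rw [hκ]; field_simp
  have hsub : ∀ x ∈ Ioo 0 δ, x ∈ Ioo (0 : ℝ) 1 := fun x hx => ⟨hx.1, hx.2.trans_le hδ1⟩
  have hderiv : ∀ x ∈ Ioo 0 δ, HasDerivAt (fun u => P u / u + κ * Real.log u)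
      (((c - f x / Ψ (P x)) * x - P x * 1) / x ^ 2 + κ * x⁻¹) x := fun x hx =>
    ((hP.hasDerivAt x (hsub x hx)).div (hasDerivAt_id x) hx.1.ne').add
      ((Real.hasDerivAt_log hx.1.ne').const_mul κ)
  have hanti : AntitoneOn (fun u => P u / u + κ * Real.log u) (Ioo 0 δ) := by
    refine antitoneOn_of_hasDerivWithinAt_nonpos (convex_Ioo 0 δ)
      (fun x hx => (hderiv x hx).continuousAt.continuousWithinAt)
      (fun x hx => (hderiv x (interior_subset hx)).hasDerivWithinAt) ?_
    intro x hx
    rw [interior_Ioo] at hx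
    have hx0 := hx.1
    have hx1 := hsub x hx
    have hPx := hP.pos x hx1
    have hΨx := hΨ.pos hPx
    have h1 : m * x / P x ≤ f x / Ψ (P x) := by
      refine (div_le_div_of_nonneg_right (hm x hx) hPx.le).trans ?_
      exact div_le_div_of_nonneg_left (hf.pos x hx1).le hΨx (hle _ hPx.le)
    have h2 : P x ≤ c * x := hP.le_mul hΨ hf h0 x (Ioo_subset_Icc_self hx1)
    -- the claim is `P x * (c * x - P x + κ * x) ≤ m * x ^ 2`
    have h3 : P x * (c * x - P x + κ * x) ≤ m * x * x := by
      have h4 : P x * (κ * x) ≤ c * x * (κ * x) :=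
        mul_le_mul_of_nonneg_right h2 (by positivity)
      have h5 : c * x * (κ * x) = (m - c ^ 2 / 4) * x ^ 2 := by rw [← hκc]; ring
      nlinarith [sq_nonneg (P x - c * x / 2)]
    have h6 : c * x - P x + κ * x ≤ m * x / P x * x := by
      rw [show m * x / P x * x = m * x * x / P x by ring, le_div_iff₀ hPx]
      linarith
    have h7 : m * x / P x * x ≤ f x / Ψ (P x) * x := mul_le_mul_of_nonneg_right h1 hx0.le
    have h8 : ((c - f x / Ψ (P x)) * x - P x * 1) / x ^ 2 + κ * x⁻¹
        = (c * x - P x + κ * x - f x / Ψ (P x) * x) / x ^ 2 := by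
      field_simp
      ring
    rw [h8]
    exact div_nonpos_of_nonpos_of_nonneg (by linarith) (by positivity)
  set u₁ := δ / 2 with hu₁
  set u₂ := u₁ * Real.exp (-(c / κ) - 1) with hu₂
  have hu₁0 : 0 < u₁ := by positivity
  have hu₂0 : 0 < u₂ := by positivity
  have hexp : Real.exp (-(c / κ) - 1) ≤ 1 := by
    rw [Real.exp_le_one_iff]
    have : 0 < c / κ := by positivity
    linarith
  have hu₂₁ : u₂ ≤ u₁ := mul_le_of_le_one_right hu₁0.le hexp
  have h1 := hanti ⟨hu₂0, by linarith⟩ ⟨hu₁0, by linarith⟩ hu₂₁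
  simp only at h1
  have hlog : Real.log u₂ = Real.log u₁ + (-(c / κ) - 1) := by
    rw [hu₂, Real.log_mul hu₁0.ne' (Real.exp_ne_zero _), Real.log_exp]
  have h2 : P u₂ / u₂ ≤ c := by
    rw [div_le_iff₀ hu₂0]
    exact hP.le_mul hΨ hf h0 u₂ ⟨hu₂0.le, by linarith⟩
  have h3 : 0 < P u₁ / u₁ := div_pos (hP.pos u₁ ⟨hu₁0, by linarith⟩) hu₁0
  have h4 : κ * (c / κ) = c := by field_simp
  rw [hlog] at h1
  nlinarith

/-! ### Decay of the slope at the two equilibria -/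

/-- Near the state `1` the slope is at most linear, by comparison with `v' = (k/c) (1 - v)`. -/
theorem IsProfile.slope_le_one_sub {p q : ℝ} {Ψ f : ℝ → ℝ} (hq : 2 ≤ q) (hqp : q < p)
    (hΨ : IsFluxInverse p q Ψ) (hf : IsFisherType f) {c : ℝ} (hc : 0 < c) {P : ℝ → ℝ}
    (hP : IsProfile Ψ f c P) {k : ℝ} (hk : 0 < k) (hfk : ∀ s ∈ Icc (0 : ℝ) 1, f s ≤ k * (1 - s)) :
    ∀ u ∈ Icc (0 : ℝ) 1, Ψ (P u) ≤ k / c * (1 - u) := by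
  set γ := k / c with hγ
  have hγ0 : 0 < γ := by positivity
  have hflux : ∀ u, u ≤ 1 → pqFlux p q (γ * (1 - u))
      = (γ * (1 - u)) ^ (p - 1) + (γ * (1 - u)) ^ (q - 1) := fun u hu =>
    pqFlux_of_nonneg hq hqp (mul_nonneg hγ0.le (by linarith))
  have key := hP.le_supersolution hΨ hf le_rfl
    (Q := fun u => (γ * (1 - u)) ^ (p - 1) + (γ * (1 - u)) ^ (q - 1))
    (Q' := fun u => γ * (-1) * (p - 1) * (γ * (1 - u)) ^ (p - 1 - 1)
      + γ * (-1) * (q - 1) * (γ * (1 - u)) ^ (q - 1 - 1)) ?_ ?_ ?_ ?_ ?_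
  · intro u hu
    have h1 := hΨ.monotone (key u hu)
    rwa [← hflux u hu.2, hΨ.left_inv _ (mul_nonneg hγ0.le (by linarith [hu.2]))] at h1
  · refine Continuous.continuousOn (Continuous.add ?_ ?_)
    · exact (Real.continuous_rpow_const (by linarith)).comp (by fun_prop)
    · exact (Real.continuous_rpow_const (by linarith)).comp (by fun_prop)
  · intro u _
    have h1 : HasDerivAt (fun u : ℝ => γ * (1 - u)) (γ * (-1)) u :=
      ((hasDerivAt_id u).const_sub 1).const_mul γ
    exact (h1.rpow_const (Or.inr (by linarith))).add (h1.rpow_const (Or.inr (by linarith)))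
  · intro u hu
    have : 0 < 1 - u := by linarith [hu.2]
    positivity
  · intro u hu
    have hu1 : 0 < 1 - u := by linarith [hu.2]
    rw [← hflux u hu.2.le, hΨ.left_inv _ (by positivity)]
    have h1 : f u / (γ * (1 - u)) ≤ c := by
      rw [div_le_iff₀ (by positivity), hγ]
      refine (hfk u (Ioo_subset_Icc_self hu)).trans (le_of_eq ?_)
      field_simp
    have h2 : 0 ≤ γ * (p - 1) * (γ * (1 - u)) ^ (p - 1 - 1) := by
      have : 0 ≤ p - 1 := by linarith
      positivity
    have h3 : 0 ≤ γ * (q - 1) * (γ * (1 - u)) ^ (q - 1 - 1) := by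
      have : 0 ≤ q - 1 := by linarith
      positivity
    linarith
  · rw [hP.map_one, sub_self, mul_zero]
    exact add_nonneg (Real.rpow_nonneg le_rfl _) (Real.rpow_nonneg le_rfl _)

theorem IsFisherType.exists_le_mul {f : ℝ → ℝ} (hf : IsFisherType f) :
    ∃ K, 0 < K ∧ ∀ u ∈ Icc (0 : ℝ) 1, f u ≤ K * u := by
  obtain ⟨K, hK⟩ := hf.contDiffOn.exists_lipschitzOnWith one_ne_zero (convex_Icc 0 1) isCompact_Icc
  refine ⟨K + 1, by positivity, fun u hu => ?_⟩
  have h1 := hK.dist_le_mul u hu 0 ⟨le_rfl, zero_le_one⟩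
  rw [Real.dist_eq, Real.dist_eq, hf.map_zero, sub_zero, sub_zero, abs_of_nonneg hu.1] at h1
  have h2 := le_abs_self (f u)
  linarith [hu.1]

/-- When `q > 2`, a profile whose slope at `0` is below the generic value `c` is small: it lies
below the flux of `v' = γ v` near `0`. Indeed, if it stayed above that curve, its derivative would
be at least `c - K/γ`, which exceeds the assumed slope when `γ` is large. -/
theorem IsProfile.exists_slope_le_mul {p q : ℝ} {Ψ f : ℝ → ℝ} (hq : 2 < q) (hqp : q < p)
    (hΨ : IsFluxInverse p q Ψ) (hf : IsFisherType f) {c : ℝ} {P : ℝ → ℝ}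
    (hP : IsProfile Ψ f c P) {c' δ : ℝ} (hc' : c' < c) (hδ : 0 < δ) (hδ1 : δ ≤ 1)
    (hle : ∀ u ∈ Ioc 0 δ, P u ≤ c' * u) :
    ∃ γ δ', 0 < δ' ∧ δ' ≤ 1 ∧ ∀ u ∈ Icc 0 δ', Ψ (P u) ≤ γ * u := by
  obtain ⟨K, hK0, hK⟩ := hf.exists_le_mul
  have hc'0 : 0 < c' := by
    have h1 := hle (δ / 2) ⟨by positivity, by linarith⟩
    have h2 := hP.pos (δ / 2) ⟨by positivity, by linarith⟩
    by_contra! h3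
    nlinarith
  set γ := 2 * K / (c - c') with hγ
  have hγ0 : 0 < γ := div_pos (by linarith) (by linarith)
  have hKγ : K / γ = (c - c') / 2 := by
    have : c - c' ≠ 0 := by linarith
    rw [hγ]
    field_simp
  set Q' : ℝ → ℝ := fun u => γ * 1 * (p - 1) * (γ * u) ^ (p - 1 - 1)
      + γ * 1 * (q - 1) * (γ * u) ^ (q - 1 - 1) with hQ'
  have hQ'c : Continuous Q' := by
    refine Continuous.add (Continuous.mul (by fun_prop) ?_) (Continuous.mul (by fun_prop) ?_)
    · exact (Real.continuous_rpow_const (by linarith)).comp (by fun_prop)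
    · exact (Real.continuous_rpow_const (by linarith)).comp (by fun_prop)
  have hQ'0 : Q' 0 = 0 := by
    simp only [hQ', mul_zero]
    rw [Real.zero_rpow (by linarith), Real.zero_rpow (by linarith)]
    ring
  have hev : ∀ᶠ u in 𝓝 (0 : ℝ), Q' u < (c + c') / 2 :=
    hQ'c.continuousAt.eventually (gt_mem_nhds (by rw [hQ'0]; linarith))
  obtain ⟨ε, hε0, hε⟩ := Metric.eventually_nhds_iff.1 hev
  set b := min δ (ε / 2) with hb
  have hb0 : 0 < b := lt_min hδ (by positivity)
  have hbδ : b ≤ δ := min_le_left _ _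
  have hQ'b : ∀ u ∈ Icc 0 b, Q' u ≤ (c + c') / 2 := by
    intro u hu
    refine (hε ?_).le
    rw [Real.dist_eq, sub_zero, abs_of_nonneg hu.1]
    linarith [hu.2, min_le_right δ (ε / 2)]
  set Q : ℝ → ℝ := fun u => (γ * u) ^ (p - 1) + (γ * u) ^ (q - 1) with hQ
  have hQflux : ∀ u, 0 ≤ u → Q u = pqFlux p q (γ * u) := fun u hu =>
    (pqFlux_of_nonneg hq.le hqp (by positivity)).symm
  have hΨQ : ∀ u, 0 ≤ u → Ψ (Q u) = γ * u := fun u hu => by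
    rw [hQflux u hu, hΨ.left_inv _ (by positivity)]
  by_cases hex : ∃ u₀ ∈ Ioc 0 b, P u₀ ≤ Q u₀
  · obtain ⟨u₀, hu₀, hPQ⟩ := hex
    refine ⟨γ, u₀, hu₀.1, by linarith [hu₀.2], fun u hu => ?_⟩
    rw [← hΨQ u hu.1]
    refine hΨ.monotone ?_
    refine hP.le_supersolution hΨ hf (by linarith [hu₀.2]) (Q' := Q') ?_ ?_ ?_ ?_ hPQ u hu
    · refine Continuous.continuousOn (Continuous.add ?_ ?_)
      · exact (Real.continuous_rpow_const (by linarith)).comp (by fun_prop)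
      · exact (Real.continuous_rpow_const (by linarith)).comp (by fun_prop)
    · intro x _
      have h1 : HasDerivAt (fun u : ℝ => γ * u) (γ * 1) x := (hasDerivAt_id x).const_mul γ
      exact (h1.rpow_const (Or.inr (by linarith))).add (h1.rpow_const (Or.inr (by linarith)))
    · intro x hx
      have := hx.1
      simp only [hQ]
      positivity
    · intro x hx
      have hx0 := hx.1
      have hx1 : x ≤ b := hx.2.le.trans hu₀.2
      rw [hΨQ x hx0.le]
      have h1 : f x / (γ * x) ≤ K / γ := by
        rw [div_le_div_iff₀ (by positivity) hγ0]
        nlinarith [hK x ⟨hx0.le, by linarith⟩]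
      linarith [hQ'b x ⟨hx0.le, hx1⟩]
  · exfalso
    push Not at hex
    have hmono : MonotoneOn (fun u => P u - (c + c') / 2 * u) (Icc 0 b) := by
      refine monotoneOn_of_hasDerivWithinAt_nonneg
        (f' := fun u => c - f u / Ψ (P u) - (c + c') / 2 * 1) (convex_Icc 0 b)
        ((hP.continuousOn.mono (Icc_subset_Icc_right (by linarith))).sub
          (by fun_prop : Continuous fun u : ℝ => (c + c') / 2 * u).continuousOn) ?_ ?_
      · intro x hx
        rw [interior_Icc] at hx
        exact ((hP.hasDerivAt x ⟨hx.1, by linarith [hx.2]⟩).sub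
          ((hasDerivAt_id x).const_mul _)).hasDerivWithinAt
      · intro x hx
        rw [interior_Icc] at hx
        have hx0 := hx.1
        have h1 : γ * x ≤ Ψ (P x) := by
          rw [← hΨQ x hx0.le]
          exact hΨ.monotone (hex x ⟨hx0, hx.2.le⟩).le
        have h2 : f x / Ψ (P x) ≤ K / γ := by
          rw [div_le_div_iff₀ (by nlinarith [mul_pos hγ0 hx0]) hγ0]
          nlinarith [hK x ⟨hx0.le, by linarith [hx.2]⟩]
        linarith
    have h1 := hmono ⟨le_rfl, hb0.le⟩ ⟨hb0.le, le_rfl⟩ hb0.le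
    simp only [mul_zero, sub_zero] at h1
    have h2 := hle b ⟨hb0, hbδ⟩
    have h3 := hP.zero_nonneg
    nlinarith

/-! ### The flux of a front is given by the profile -/

/-- A differentiable function with values in `[0,1]` cannot have a slope bounded below by a positive
constant on a long interval. -/
theorem not_forall_le_deriv {v : ℝ → ℝ} (hv : Differentiable ℝ v) (h01 : ∀ z, v z ∈ Icc (0 : ℝ) 1)
    {η : ℝ} (hη : 0 < η) (a : ℝ) : ¬ ∀ z ∈ Icc a (a + 2 / η), η ≤ deriv v z := by
  intro h
  have hle : a ≤ a + 2 / η := by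
    have : 0 < 2 / η := by positivity
    linarith
  have h1 := (convex_Icc a (a + 2 / η)).mul_sub_le_image_sub_of_le_deriv
    hv.continuous.continuousOn hv.differentiableOn (fun x hx => h x (interior_subset hx))
    a ⟨le_rfl, hle⟩ (a + 2 / η) ⟨hle, le_rfl⟩ hle
  have h2 : η * (a + 2 / η - a) = 2 := by field_simp; ring
  linarith [(h01 a).1, (h01 (a + 2 / η)).2]

namespace IsMonotoneFront

variable {p q c : ℝ} {Ψ f v : ℝ → ℝ}

theorem mem_Icc (h : IsMonotoneFront p q f c v) (z : ℝ) : v z ∈ Icc (0 : ℝ) 1 :=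
  ⟨h.monotone.le_of_tendsto h.tendsto_atBot z, h.monotone.ge_of_tendsto h.tendsto_atTop z⟩

theorem deriv_nonneg (h : IsMonotoneFront p q f c v) (z : ℝ) : 0 ≤ deriv v z :=
  h.monotone.deriv_nonneg

theorem hasDerivAt_flux (h : IsMonotoneFront p q f c v) (z : ℝ) :
    HasDerivAt (fun x => pqFlux p q (deriv v x)) (c * deriv v z - f (v z)) z := by
  obtain ⟨w, hw, he⟩ := h.ode z
  exact hw.congr_deriv (by linarith)

/-- If `c ≤ 0` the flux is nonincreasing, so it cannot be positive anywhere: the slope would be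
bounded below by a positive constant on a left half line. -/
theorem speed_pos (h : IsMonotoneFront p q f c v) (hΨ : IsFluxInverse p q Ψ)
    (hf : IsFisherType f) : 0 < c := by
  by_contra! hc
  have hanti : Antitone fun x => pqFlux p q (deriv v x) := by
    refine antitone_of_hasDerivAt_nonpos (fun x => h.hasDerivAt_flux x) fun x => ?_
    have h1 := hf.nonneg _ (h.mem_Icc x)
    have h3 : c * deriv v x ≤ 0 := mul_nonpos_of_nonpos_of_nonneg hc (h.deriv_nonneg x)
    simp only [Pi.zero_apply]
    linarith
  have hzero : ∀ z, deriv v z = 0 := by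
    intro z
    by_contra hz
    have hη : 0 < deriv v z := (h.deriv_nonneg z).lt_of_ne' hz
    refine not_forall_le_deriv h.differentiable h.mem_Icc hη (z - 2 / deriv v z) fun x hx => ?_
    have h1 := hΨ.monotone (hanti (show x ≤ z by linarith [hx.2]))
    simp only at h1
    rwa [hΨ.left_inv _ hη.le, hΨ.left_inv _ (h.deriv_nonneg x)] at h1
  have hconst : ∀ z, v z = v 0 := fun z => is_const_of_deriv_eq_zero h.differentiable hzero z 0
  have h0 := tendsto_nhds_unique (h.tendsto_atBot.congr hconst) tendsto_const_nhds
  have h1 := tendsto_nhds_unique (h.tendsto_atTop.congr hconst) tendsto_const_nhds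
  linarith

/-- The flux minus `c v` is nonincreasing, so the flux converges at `+∞`; the limit of the slope
must vanish since `v` is bounded. -/
theorem tendsto_flux_atTop (h : IsMonotoneFront p q f c v) (hΨ : IsFluxInverse p q Ψ)
    (hf : IsFisherType f) (hc : 0 < c) :
    Tendsto (fun x => pqFlux p q (deriv v x)) atTop (𝓝 0) := by
  have hfl0 : ∀ x, 0 ≤ pqFlux p q (deriv v x) := fun x => pqFlux_nonneg (h.deriv_nonneg x)
  have hanti : Antitone fun x => pqFlux p q (deriv v x) - c * v x := by
    refine antitone_of_hasDerivAt_nonpos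
      (fun x => (h.hasDerivAt_flux x).sub ((h.differentiable x).hasDerivAt.const_mul c)) fun x => ?_
    simp only [Pi.zero_apply]
    linarith [hf.nonneg _ (h.mem_Icc x)]
  have hbdd : BddBelow (range fun x => pqFlux p q (deriv v x) - c * v x) := by
    refine ⟨-c, ?_⟩
    rintro _ ⟨x, rfl⟩
    nlinarith [hfl0 x, (h.mem_Icc x).2]
  obtain ⟨l, hl⟩ : ∃ l, Tendsto (fun x => pqFlux p q (deriv v x)) atTop (𝓝 l) := by
    refine ⟨_, ((tendsto_atTop_ciInf hanti hbdd).add (h.tendsto_atTop.const_mul c)).congr ?_⟩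
    intro x
    ring
  have hl0 : 0 ≤ l := ge_of_tendsto' hl hfl0
  rcases hl0.eq_or_lt with rfl | hlpos
  · exact hl
  exfalso
  have hη := hΨ.pos (half_pos hlpos)
  obtain ⟨a, ha⟩ := eventually_atTop.1 (hl.eventually (lt_mem_nhds (half_lt_self hlpos)))
  refine not_forall_le_deriv h.differentiable h.mem_Icc hη a fun x hx => ?_
  have h1 := hΨ.monotone (ha x hx.1).le
  rwa [hΨ.left_inv _ (h.deriv_nonneg x)] at h1

/-- A front traces its profile: the energies of its flux and of the profile along `v` have a
difference `D` with `(D²)' ≥ 0`, by monotonicity of the inverse flux, and `D → 0` at `+∞`. -/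
theorem flux_eq_profile (h : IsMonotoneFront p q f c v) (hΨ : IsFluxInverse p q Ψ)
    (hf : IsFisherType f) {P : ℝ → ℝ} (hP : IsProfile Ψ f c P) (z : ℝ) :
    pqFlux p q (deriv v z) = P (v z) := by
  have hc := h.speed_pos hΨ hf
  have hfl0 : ∀ x, 0 ≤ pqFlux p q (deriv v x) := fun x => pqFlux_nonneg (h.deriv_nonneg x)
  set D : ℝ → ℝ := fun x => fluxEnergy Ψ (pqFlux p q (deriv v x)) - fluxEnergy Ψ (P (v x)) with hD
  have hDd : ∀ x, HasDerivAt D (c * deriv v x * (deriv v x - Ψ (P (v x)))) x := by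
    intro x
    have h1 := (hΨ.hasDerivAt_fluxEnergy (pqFlux p q (deriv v x))).comp x (h.hasDerivAt_flux x)
    have h2 := (hP.hasDerivWithinAt_energy (v x) (h.mem_Icc x)).comp x
      (h.differentiable x).hasDerivAt.hasDerivWithinAt (s := univ) fun y _ => h.mem_Icc y
    rw [hasDerivWithinAt_univ] at h2
    refine (h1.sub h2).congr_deriv ?_
    rw [hΨ.left_inv _ (h.deriv_nonneg x)]
    ring
  have hmono : Monotone fun x => D x ^ 2 := by
    refine monotone_of_hasDerivAt_nonneg (fun x => (hDd x).pow 2) fun x => ?_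
    have hmG := hΨ.strictMonoOn_fluxEnergy.monotoneOn
    have hsign : 0 ≤ D x * (deriv v x - Ψ (P (v x))) := by
      rcases le_total (pqFlux p q (deriv v x)) (P (v x)) with hle | hle
      · refine mul_nonneg_of_nonpos_of_nonpos (sub_nonpos.2 ?_) (sub_nonpos.2 ?_)
        · exact hmG (hfl0 x) (hP.nonneg _ (h.mem_Icc x)) hle
        · simpa only [hΨ.left_inv _ (h.deriv_nonneg x)] using hΨ.monotone hle
      · refine mul_nonneg (sub_nonneg.2 ?_) (sub_nonneg.2 ?_)
        · exact hmG (hP.nonneg _ (h.mem_Icc x)) (hfl0 x) hle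
        · simpa only [hΨ.left_inv _ (h.deriv_nonneg x)] using hΨ.monotone hle
    have h3 := mul_nonneg (mul_nonneg hc.le (h.deriv_nonneg x)) hsign
    simp only [Pi.zero_apply]
    norm_num
    linarith
  have hlim : Tendsto D atTop (𝓝 0) := by
    have h1 := (hΨ.continuous_fluxEnergy.tendsto 0).comp (h.tendsto_flux_atTop hΨ hf hc)
    have h2 : Tendsto (fun x => P (v x)) atTop (𝓝 (P 1)) :=
      (hP.continuousOn 1 ⟨zero_le_one, le_rfl⟩).tendsto.comp
        (tendsto_nhdsWithin_iff.2 ⟨h.tendsto_atTop, Eventually.of_forall h.mem_Icc⟩)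
    rw [hP.map_one] at h2
    simpa using h1.sub ((hΨ.continuous_fluxEnergy.tendsto 0).comp h2)
  have hle : D z ^ 2 ≤ 0 := by
    have h2 := hmono.ge_of_tendsto (hlim.pow 2) z
    simpa using h2
  have hDz : D z = 0 := by nlinarith [sq_nonneg (D z)]
  exact hΨ.strictMonoOn_fluxEnergy.injOn (hfl0 z) (hP.nonneg _ (h.mem_Icc z)) (sub_eq_zero.1 hDz)

theorem profile_map_zero (h : IsMonotoneFront p q f c v) (hΨ : IsFluxInverse p q Ψ)
    (hf : IsFisherType f) {P : ℝ → ℝ} (hP : IsProfile Ψ f c P) : P 0 = 0 := by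
  by_contra hne
  have hP0 : 0 < P 0 := hP.zero_nonneg.lt_of_ne' hne
  have h2 : Tendsto (fun x => P (v x)) atBot (𝓝 (P 0)) :=
    (hP.continuousOn 0 ⟨le_rfl, zero_le_one⟩).tendsto.comp
      (tendsto_nhdsWithin_iff.2 ⟨h.tendsto_atBot, Eventually.of_forall h.mem_Icc⟩)
  have hη := hΨ.pos (half_pos hP0)
  obtain ⟨a, ha⟩ := eventually_atBot.1 (h2.eventually (lt_mem_nhds (half_lt_self hP0)))
  refine not_forall_le_deriv h.differentiable h.mem_Icc hη (a - 2 / Ψ (P 0 / 2)) fun x hx => ?_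
  have h1 := hΨ.monotone (ha x (by linarith [hx.2])).le
  rwa [← h.flux_eq_profile hΨ hf hP x, hΨ.left_inv _ (h.deriv_nonneg x)] at h1

end IsMonotoneFront

/-! ### Construction of a front from its profile -/

/-- Separation of variables for `v' = s(v)` between two consecutive zeros of `s`. If the time
`∫ du / s(u)` to reach `0` or `1` is finite, the solution is continued by that constant. -/
theorem exists_monotone_solution {s : ℝ → ℝ} (hs : ContinuousOn s (Icc 0 1))
    (hpos : ∀ u ∈ Ioo (0 : ℝ) 1, 0 < s u) :
    ∃ v : ℝ → ℝ, Monotone v ∧ Continuous v ∧ (∀ z, v z ∈ Icc (0 : ℝ) 1) ∧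
      Tendsto v atBot (𝓝 0) ∧ Tendsto v atTop (𝓝 1) ∧
      ∀ z, v z ∈ Ioo (0 : ℝ) 1 → HasDerivAt v (s (v z)) z := by
  set T : ℝ → ℝ := fun u => ∫ x in (1 / 2 : ℝ)..u, (s x)⁻¹ with hT
  have hinv : ContinuousOn (fun x => (s x)⁻¹) (Ioo 0 1) :=
    (hs.mono Ioo_subset_Icc_self).inv₀ fun x hx => (hpos x hx).ne'
  have hTd : ∀ u ∈ Ioo (0 : ℝ) 1, HasDerivAt T (s u)⁻¹ u := by
    intro u hu
    refine intervalIntegral.integral_hasDerivAt_right ?_ ?_ ?_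
    · refine (hinv.mono ?_).intervalIntegrable
      exact (ordConnected_Ioo (a := (0 : ℝ)) (b := 1)).uIcc_subset (by norm_num) hu
    · exact hinv.stronglyMeasurableAtFilter isOpen_Ioo u hu
    · exact hinv.continuousAt (isOpen_Ioo.mem_nhds hu)
  have hTc : ∀ u ∈ Ioo (0 : ℝ) 1, ContinuousAt T u := fun u hu => (hTd u hu).continuousAt
  have hTm : StrictMonoOn T (Ioo 0 1) := by
    refine strictMonoOn_of_deriv_pos (convex_Ioo 0 1)
      (fun u hu => (hTc u hu).continuousWithinAt) fun u hu => ?_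
    rw [interior_Ioo] at hu
    rw [(hTd u hu).deriv]
    exact inv_pos.2 (hpos u hu)
  set A : ℝ → Set ℝ := fun z => insert 0 {u | u ∈ Ioo (0 : ℝ) 1 ∧ T u ≤ z} with hA
  have hA0 : ∀ z, (0 : ℝ) ∈ A z := fun z => mem_insert _ _
  have hA1 : ∀ z, ∀ u ∈ A z, u ≤ 1 := by
    rintro z u (rfl | hu)
    · exact zero_le_one
    · exact hu.1.2.le
  have hAb : ∀ z, BddAbove (A z) := fun z => ⟨1, hA1 z⟩
  set v : ℝ → ℝ := fun z => sSup (A z) with hv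
  have hv01 : ∀ z, v z ∈ Icc (0 : ℝ) 1 := fun z =>
    ⟨le_csSup (hAb z) (hA0 z), csSup_le ⟨0, hA0 z⟩ (hA1 z)⟩
  have hvm : Monotone v := by
    intro y z hyz
    refine csSup_le_csSup (hAb z) ⟨0, hA0 y⟩ (insert_subset_insert ?_)
    exact fun u hu => ⟨hu.1, hu.2.trans hyz⟩
  have hvT : ∀ u ∈ Ioo (0 : ℝ) 1, v (T u) = u := by
    intro u hu
    refine IsGreatest.csSup_eq ⟨mem_insert_of_mem _ ⟨hu, le_rfl⟩, ?_⟩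
    rintro x (rfl | hx)
    · exact hu.1.le
    · exact (hTm.le_iff_le hx.1 hu).1 hx.2
  have hTv : ∀ z, v z ∈ Ioo (0 : ℝ) 1 → T (v z) = z := by
    intro z hz
    have hnhds : ∀ᶠ x in 𝓝 (v z), x ∈ Ioo (0 : ℝ) 1 := isOpen_Ioo.mem_nhds hz
    rcases lt_trichotomy (T (v z)) z with hlt | heq | hgt
    · exfalso
      obtain ⟨x, ⟨hx1, hx2⟩, hx3⟩ := ((((hTc _ hz).eventually (gt_mem_nhds hlt)).and
        hnhds).filter_mono nhdsWithin_le_nhds |>.and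
        (self_mem_nhdsWithin : Ioi (v z) ∈ 𝓝[>] (v z))).exists
      exact absurd (le_csSup (hAb z) (mem_insert_of_mem _ ⟨hx2, hx1.le⟩)) (not_le.2 hx3)
    · exact heq
    · exfalso
      obtain ⟨x, ⟨hx1, hx2⟩, hx3⟩ := ((((hTc _ hz).eventually (lt_mem_nhds hgt)).and
        hnhds).filter_mono nhdsWithin_le_nhds |>.and
        (self_mem_nhdsWithin : Iio (v z) ∈ 𝓝[<] (v z))).exists
      refine absurd (csSup_le ⟨0, hA0 z⟩ ?_ : v z ≤ x) (not_le.2 hx3)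
      rintro y (rfl | hy)
      · exact hx2.1.le
      · exact ((hTm.lt_iff_lt hy.1 hx2).1 (hy.2.trans_lt hx1)).le
  have hvc : Continuous v := by
    have hmono : Monotone fun z => (⟨v z, hv01 z⟩ : Icc (0 : ℝ) 1) := fun y z hyz => hvm hyz
    have hdense : DenseRange fun z => (⟨v z, hv01 z⟩ : Icc (0 : ℝ) 1) := by
      refine dense_of_exists_between fun {a b} hab => ?_
      obtain ⟨x, hax, hxb⟩ := exists_between (show (a : ℝ) < b from hab)
      have hx : x ∈ Ioo (0 : ℝ) 1 := ⟨a.2.1.trans_lt hax, hxb.trans_le b.2.2⟩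
      exact ⟨⟨v (T x), hv01 _⟩, ⟨T x, rfl⟩, by
        rw [← Subtype.coe_lt_coe]; simpa only [hvT x hx] using hax, by
        rw [← Subtype.coe_lt_coe]; simpa only [hvT x hx] using hxb⟩
    exact continuous_subtype_val.comp (hmono.continuous_of_denseRange hdense)
  refine ⟨v, hvm, hvc, hv01, ?_, ?_, ?_⟩
  · rw [tendsto_order]
    refine ⟨fun a ha => Eventually.of_forall fun z => ha.trans_le (hv01 z).1, fun a ha => ?_⟩
    obtain ⟨x, hx0, hx1⟩ := exists_between (lt_min ha one_pos)
    have hx : x ∈ Ioo (0 : ℝ) 1 := ⟨hx0, hx1.trans_le (min_le_right _ _)⟩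
    filter_upwards [eventually_le_atBot (T x)] with z hz
    have := hvm hz
    rw [hvT x hx] at this
    exact this.trans_lt (hx1.trans_le (min_le_left _ _))
  · rw [tendsto_order]
    refine ⟨fun a ha => ?_, fun a ha => Eventually.of_forall fun z => (hv01 z).2.trans_lt ha⟩
    obtain ⟨x, hx0, hx1⟩ := exists_between (max_lt ha zero_lt_one)
    have hx : x ∈ Ioo (0 : ℝ) 1 := ⟨(le_max_right _ _).trans_lt hx0, hx1⟩
    filter_upwards [eventually_ge_atTop (T x)] with z hz
    have := hvm hz
    rw [hvT x hx] at this
    exact ((le_max_left _ _).trans_lt hx0).trans_le this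
  · intro z hz
    have h1 := HasDerivAt.of_local_left_inverse hvc.continuousAt (hTd _ hz)
      (inv_ne_zero (hpos _ hz).ne') (by
        filter_upwards [hvc.continuousAt.eventually (isOpen_Ioo.mem_nhds hz)] with x hx
        exact hTv x hx)
    rwa [inv_inv] at h1

/-- A continuous function of a monotone transition `v` that satisfies a differential equation while
`0 < v < 1` satisfies it everywhere if the right-hand side is continuous and vanishes at the two
end states: only the times when `v` leaves `0` or reaches `1` are exceptional. -/
theorem hasDerivAt_comp_of_transition {v H g : ℝ → ℝ} (hvm : Monotone v) (hvc : Continuous v)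
    (hv01 : ∀ z, v z ∈ Icc (0 : ℝ) 1) (hH : ContinuousOn H (Icc 0 1))
    (hg : ContinuousOn g (Icc 0 1)) (hg0 : g 0 = 0) (hg1 : g 1 = 0)
    (hd : ∀ z, v z ∈ Ioo (0 : ℝ) 1 → HasDerivAt (fun x => H (v x)) (g (v z)) z) (z : ℝ) :
    HasDerivAt (fun x => H (v x)) (g (v z)) z := by
  have hHc : Continuous fun x => H (v x) := hH.comp_continuous hvc hv01
  have hgc : Continuous fun x => g (v x) := hg.comp_continuous hvc hv01
  set E₀ : Set ℝ := {x | v x = 0 ∧ ∀ y, x < y → 0 < v y} with hE₀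
  set E₁ : Set ℝ := {x | v x = 1 ∧ ∀ y, y < x → v y < 1} with hE₁
  have h₀ : E₀.Subsingleton := by
    intro x hx y hy
    rcases lt_trichotomy x y with h | h | h
    · exact absurd hy.1 (hx.2 y h).ne'
    · exact h
    · exact absurd hx.1 (hy.2 x h).ne'
  have h₁ : E₁.Subsingleton := by
    intro x hx y hy
    rcases lt_trichotomy x y with h | h | h
    · exact absurd hx.1 (hy.2 x h).ne
    · exact h
    · exact absurd hy.1 (hx.2 y h).ne
  have hoff : ∀ x, x ∉ E₀ ∪ E₁ → HasDerivAt (fun x => H (v x)) (g (v x)) x := by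
    intro x hx
    rw [mem_union, not_or] at hx
    rcases (hv01 x).1.eq_or_lt with h0 | h0
    · obtain ⟨y, hxy, hy⟩ : ∃ y, x < y ∧ v y ≤ 0 := by
        by_contra! hcon
        exact hx.1 ⟨h0.symm, hcon⟩
      rw [← h0, hg0]
      refine (hasDerivAt_const x (H 0)).congr_of_eventuallyEq ?_
      filter_upwards [gt_mem_nhds hxy] with w hw
      rw [le_antisymm ((hvm hw.le).trans hy) (hv01 w).1]
    rcases (hv01 x).2.eq_or_lt with h1 | h1
    · obtain ⟨y, hxy, hy⟩ : ∃ y, y < x ∧ 1 ≤ v y := by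
        by_contra! hcon
        exact hx.2 ⟨h1, hcon⟩
      rw [h1, hg1]
      refine (hasDerivAt_const x (H 1)).congr_of_eventuallyEq ?_
      filter_upwards [lt_mem_nhds hxy] with w hw
      rw [le_antisymm (hv01 w).2 (hy.trans (hvm hw.le))]
    · exact hd x ⟨h0, h1⟩
  have hint : ∀ x, H (v x) = H (v 0) + ∫ t in (0 : ℝ)..x, g (v t) := by
    intro x
    rw [MeasureTheory.integral_eq_of_hasDerivAt_off_countable (fun x => H (v x))
      (fun x => g (v x)) (h₀.countable.union h₁.countable) hHc.continuousOn
      (fun t ht => hoff t ht.2) (hgc.intervalIntegrable _ _)]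
    ring
  have h2 : HasDerivAt (fun x => H (v 0) + ∫ t in (0 : ℝ)..x, g (v t)) (g (v z)) z :=
    (intervalIntegral.integral_hasDerivAt_right (hgc.intervalIntegrable _ _)
      hgc.aestronglyMeasurable.stronglyMeasurableAtFilter hgc.continuousAt).const_add _
  exact h2.congr_of_eventuallyEq (Eventually.of_forall hint)

/-- A profile that vanishes at `0` produces a front, whose slope is `Ψ (P v)`. -/
theorem IsProfile.exists_isMonotoneFront {p q c : ℝ} {Ψ f P : ℝ → ℝ} (hΨ : IsFluxInverse p q Ψ)
    (hf : IsFisherType f) (hP : IsProfile Ψ f c P) (h0 : P 0 = 0) :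
    ∃ v, IsMonotoneFront p q f c v ∧ ∀ z, HasDerivAt v (Ψ (P (v z))) z := by
  have hs : ContinuousOn (fun u => Ψ (P u)) (Icc 0 1) :=
    hΨ.continuous.comp_continuousOn hP.continuousOn
  have hz : Ψ 0 = 0 := hΨ.eq_zero 0 le_rfl
  obtain ⟨v, hvm, hvc, hv01, hvb, hvt, hvd⟩ := exists_monotone_solution hs
    fun u hu => hΨ.pos (hP.pos u hu)
  have hd : ∀ z, HasDerivAt v (Ψ (P (v z))) z :=
    hasDerivAt_comp_of_transition (H := id) (g := fun u => Ψ (P u)) hvm hvc hv01 continuousOn_id hs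
      (by rw [h0, hz]) (by rw [hP.map_one, hz]) hvd
  have hflux : ∀ z, HasDerivAt (fun x => P (v x)) (c * Ψ (P (v z)) - f (v z)) z := by
    refine hasDerivAt_comp_of_transition (g := fun u => c * Ψ (P u) - f u) hvm hvc hv01
      hP.continuousOn ((hs.const_smul c).sub hf.contDiffOn.continuousOn) ?_ ?_ fun z hz' => ?_
    · rw [h0, hz, hf.map_zero, mul_zero, sub_zero]
    · rw [hP.map_one, hz, hf.map_one, mul_zero, sub_zero]
    · refine ((hP.hasDerivAt _ hz').comp z (hd z)).congr_deriv ?_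
      have := (hΨ.pos (hP.pos _ hz')).ne'
      field_simp
  refine ⟨v, ⟨fun z => (hd z).differentiableAt, hvm, fun z => ?_, hvb, hvt⟩, hd⟩
  refine ⟨c * Ψ (P (v z)) - f (v z), ?_, ?_⟩
  · refine (hflux z).congr_of_eventuallyEq (Eventually.of_forall fun x => ?_)
    simp only
    rw [(hd x).deriv, hΨ.right_inv _ (hP.nonneg _ (hv01 x))]
  · rw [(hd z).deriv]
    ring

/-- If the slope is at most linear at both end states, the front never reaches them, by
Grönwall's inequality. -/
theorem IsProfile.exists_isStrictFront {p q c : ℝ} {Ψ f P : ℝ → ℝ} (hΨ : IsFluxInverse p q Ψ)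
    (hf : IsFisherType f) (hP : IsProfile Ψ f c P) (h0 : P 0 = 0) {a b : ℝ}
    (ha : ∀ u ∈ Icc (0 : ℝ) 1, Ψ (P u) ≤ a * u)
    (hb : ∀ u ∈ Icc (0 : ℝ) 1, Ψ (P u) ≤ b * (1 - u)) :
    ∃ v, IsStrictFront p q f c v := by
  obtain ⟨v, hv, hd⟩ := hP.exists_isMonotoneFront hΨ hf h0
  have hexp : ∀ r z, HasDerivAt (fun x => Real.exp (r * x)) (Real.exp (r * z) * (r * 1)) z :=
    fun r z => ((hasDerivAt_id z).const_mul r).exp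
  have hpos : ∀ z, 0 < v z := by
    have hanti : Antitone fun x => v x * Real.exp (-a * x) := by
      refine antitone_of_hasDerivAt_nonpos (fun x => (hd x).mul (hexp (-a) x)) fun x => ?_
      have h1 := mul_nonneg (Real.exp_pos (-a * x)).le (sub_nonneg.2 (ha _ (hv.mem_Icc x)))
      simp only [Pi.zero_apply]
      linarith
    intro z
    refine (hv.mem_Icc z).1.lt_of_ne' fun hz => ?_
    have hev : ∀ᶠ x in atTop, v x = 0 := by
      filter_upwards [eventually_ge_atTop z] with x hx
      have h1 := hanti hx
      simp only [hz, zero_mul] at h1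
      exact le_antisymm (nonpos_of_mul_nonpos_left h1 (Real.exp_pos _)) (hv.mem_Icc x).1
    exact zero_ne_one (tendsto_nhds_unique (tendsto_const_nhds.congr'
      (hev.mono fun x hx => hx.symm)) hv.tendsto_atTop)
  have hlt : ∀ z, v z < 1 := by
    have hmono : Monotone fun x => (1 - v x) * Real.exp (b * x) := by
      refine monotone_of_hasDerivAt_nonneg
        (fun x => ((hd x).const_sub 1).mul (hexp b x)) fun x => ?_
      have h1 := mul_nonneg (Real.exp_pos (b * x)).le (sub_nonneg.2 (hb _ (hv.mem_Icc x)))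
      simp only [Pi.zero_apply]
      linarith
    intro z
    refine (hv.mem_Icc z).2.lt_of_ne fun hz => ?_
    have hev : ∀ᶠ x in atBot, v x = 1 := by
      filter_upwards [eventually_le_atBot z] with x hx
      have h1 := hmono hx
      simp only [hz, sub_self, zero_mul] at h1
      have h2 := nonpos_of_mul_nonpos_left h1 (Real.exp_pos _)
      exact le_antisymm (hv.mem_Icc x).2 (by linarith)
    exact one_ne_zero (tendsto_nhds_unique (tendsto_const_nhds.congr'
      (hev.mono fun x hx => hx.symm)) hv.tendsto_atBot)
  refine ⟨v, hv, fun z => ?_⟩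
  rw [(hd z).deriv]
  exact hΨ.pos (hP.pos _ ⟨hpos z, hlt z⟩)

/-! ### Admissible speeds -/

theorem conjExponent_sub_one {q : ℝ} (hq : 2 ≤ q) : q.conjExponent - 1 = 1 / (q - 1) := by
  have : q - 1 ≠ 0 := by linarith
  rw [Real.conjExponent]
  field_simp
  ring

/-- For `q > 2` the power `s^(q'-1)` dominates the differentiable function `f` near `0`. -/
theorem IsFisherType.limit_eq_zero {f : ℝ → ℝ} (hf : IsFisherType f) {q L₀ : ℝ} (hq : 2 < q)
    (hL₀ : Tendsto (fun s => f s / s ^ (q.conjExponent - 1)) (𝓝[>] 0) (𝓝 L₀)) : L₀ = 0 := by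
  obtain ⟨K, hK0, hK⟩ := hf.exists_le_mul
  have hq1 : 0 < q - 1 := by linarith
  have hr : 0 < 1 - 1 / (q - 1) := by
    rw [sub_pos, div_lt_one hq1]
    linarith
  rw [conjExponent_sub_one hq.le] at hL₀
  have hlim : Tendsto (fun s : ℝ => K * s ^ (1 - 1 / (q - 1))) (𝓝[>] 0) (𝓝 0) := by
    have h1 := ((Real.continuous_rpow_const hr.le).const_mul K).tendsto 0
    rw [Real.zero_rpow hr.ne', mul_zero] at h1
    exact h1.mono_left nhdsWithin_le_nhds
  have hev : ∀ᶠ s : ℝ in 𝓝[>] 0, s ∈ Ioo (0 : ℝ) 1 := Ioo_mem_nhdsGT one_pos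
  refine tendsto_nhds_unique hL₀ (squeeze_zero' ?_ ?_ hlim)
  · filter_upwards [hev] with s hs
    exact div_nonneg (hf.pos s hs).le (Real.rpow_nonneg hs.1.le _)
  · filter_upwards [hev] with s hs
    rw [div_le_iff₀ (Real.rpow_pos_of_pos hs.1 _), mul_assoc, ← Real.rpow_add hs.1,
      sub_add_cancel, Real.rpow_one]
    exact hK s (Ioo_subset_Icc_self hs)

/-- The lower bound for admissible speeds. It is the classical linear bound `2 √(f'(0))` for `q = 2`
and reduces to `0 ≤ c` for `q > 2`. -/
theorem IsProfile.lower_bound {p q : ℝ} {Ψ f : ℝ → ℝ} (hq : 2 ≤ q) (hqp : q < p)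
    (hΨ : IsFluxInverse p q Ψ) (hf : IsFisherType f) {c : ℝ} {P : ℝ → ℝ} (hP : IsProfile Ψ f c P)
    (h0 : P 0 = 0) {L₀ : ℝ}
    (hL₀ : Tendsto (fun s => f s / s ^ (q.conjExponent - 1)) (𝓝[>] 0) (𝓝 L₀)) :
    L₀ ^ (1 / q.conjExponent) * q.conjExponent ^ (1 / q.conjExponent) * q ^ (1 / q) ≤ c := by
  have hc : 0 < c := hP.speed_pos hΨ hf h0
  rcases hq.eq_or_lt with rfl | hq2
  · have hconj : (2 : ℝ).conjExponent = 2 := by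
      rw [Real.conjExponent]
      norm_num
    rw [hconj] at hL₀ ⊢
    have hsq : 4 * L₀ ≤ c ^ 2 := by
      suffices h : ∀ m < L₀, m ≤ c ^ 2 / 4 by
        have := le_of_forall_lt_imp_le_of_dense h
        linarith
      intro m hm
      obtain ⟨b, hb0, hb⟩ := mem_nhdsGT_iff_exists_Ioo_subset.1 (hL₀.eventually (lt_mem_nhds hm))
      have h1 := hP.four_mul_le_sq hΨ hf h0 (fun y hy => hΨ.le_self hqp hy) (m := m)
        (lt_min (mem_Ioi.1 hb0) one_pos) (min_le_right _ _) fun u hu => by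
          have h2 : m < f u / u ^ ((2 : ℝ) - 1) := hb ⟨hu.1, hu.2.trans_le (min_le_left _ _)⟩
          rw [show (2 : ℝ) - 1 = 1 by norm_num, Real.rpow_one, lt_div_iff₀ hu.1] at h2
          exact h2.le
      linarith
    rw [← Real.sqrt_eq_rpow, ← Real.sqrt_eq_rpow, mul_assoc, Real.mul_self_sqrt zero_le_two]
    have h3 : √L₀ ≤ c / 2 := Real.sqrt_le_iff.2 ⟨by positivity, by linarith [div_pow c 2 2]⟩
    linarith
  · have hexp : 1 / q.conjExponent ≠ 0 := by
      have h1 : 0 < q / (q - 1) := div_pos (by linarith) (by linarith)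
      rw [Real.conjExponent]
      positivity
    rw [hf.limit_eq_zero hq2 hL₀, Real.zero_rpow hexp, zero_mul, zero_mul]
    exact hc.le

/-- A linear bound for the slope near `0` extends to `[0,1]`, so the front is strict. -/
theorem IsProfile.exists_isStrictFront_of_local {p q c : ℝ} {Ψ f P : ℝ → ℝ} (hq : 2 ≤ q)
    (hqp : q < p) (hΨ : IsFluxInverse p q Ψ) (hf : IsFisherType f) (hP : IsProfile Ψ f c P)
    (h0 : P 0 = 0) {k : ℝ} (hk : 0 < k) (hfk : ∀ s ∈ Icc (0 : ℝ) 1, f s ≤ k * (1 - s))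
    {γ δ : ℝ} (hδ : 0 < δ) (hγ : ∀ u ∈ Icc 0 δ, Ψ (P u) ≤ γ * u) :
    ∃ v, IsStrictFront p q f c v := by
  have hc : 0 < c := hP.speed_pos hΨ hf h0
  have hb := hP.slope_le_one_sub hq hqp hΨ hf hc hk hfk
  refine hP.exists_isStrictFront hΨ hf h0 (a := max γ (k / c / δ)) (fun u hu => ?_) hb
  rcases le_total u δ with hle | hle
  · exact (hγ u ⟨hu.1, hle⟩).trans (mul_le_mul_of_nonneg_right (le_max_left _ _) hu.1)
  · have hkc : 0 < k / c := by positivity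
    calc Ψ (P u) ≤ k / c * (1 - u) := hb u hu
      _ ≤ k / c * 1 := mul_le_mul_of_nonneg_left (by linarith [hu.1]) hkc.le
      _ = k / c / δ * δ := by field_simp
      _ ≤ max γ (k / c / δ) * u := mul_le_mul (le_max_right _ _) hle hδ.le
          ((by positivity : 0 ≤ k / c / δ).trans (le_max_right _ _))

theorem theorem2p1 (p q : ℝ) (hq : 2 ≤ q) (hqp : q < p)
    (f : ℝ → ℝ) (hf : IsFisherType f) (L₀ Lp : ℝ)
    (hL₀ : Tendsto (fun s => f s / s ^ (q.conjExponent - 1)) (𝓝[>] 0) (𝓝 L₀))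
    (hLp : IsLUB ((fun s => f s / s ^ (q.conjExponent - 1)) '' Ioc 0 1) Lp)
    (k : ℝ) (hk : 0 < k) (hfk : ∀ s ∈ Icc (0 : ℝ) 1, f s ≤ k * (1 - s)) :
    ∃ cstar : ℝ,
      L₀ ^ (1 / q.conjExponent) * q.conjExponent ^ (1 / q.conjExponent) * q ^ (1 / q) ≤ cstar ∧
      cstar ≤ cPlus p q Lp ∧
      (∀ c : ℝ, (∃ v, IsMonotoneFront p q f c v) ↔ cstar ≤ c) ∧
      (∀ c : ℝ, cstar ≤ c → (q = 2 ∨ cstar < c ∨ c = cPlus p q Lp) →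
        ∃ v, IsStrictFront p q f c v) := by
  obtain ⟨Ψ, hΨ⟩ := exists_isFluxInverse hq hqp
  have hq1 : 0 < q - 1 := by linarith
  have hr : 1 < (p - 1) / (q - 1) := by
    rw [lt_div_iff₀ hq1]
    linarith
  have hfL : ∀ u ∈ Ioo (0 : ℝ) 1, f u ≤ Lp * u ^ (1 / (q - 1)) := by
    intro u hu
    have h1 := hLp.1 (mem_image_of_mem _ (Ioo_subset_Ioc_self hu))
    rwa [conjExponent_sub_one hq, div_le_iff₀ (Real.rpow_pos_of_pos hu.1 _)] at h1
  have hLpos : 0 < Lp := by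
    have h1 : (1 / 2 : ℝ) ∈ Ioo (0 : ℝ) 1 := by norm_num
    exact pos_of_mul_pos_left ((hf.pos _ h1).trans_le (hfL _ h1)) (by positivity)
  obtain ⟨β, hβ, hβc⟩ := exists_slope_le_cPlus hq hqp hLpos
  have hβp : 0 < β ^ (p - 1) := Real.rpow_pos_of_pos hβ _
  have hβq : 0 < β ^ (q - 1) := Real.rpow_pos_of_pos hβ _
  have hβlt : β ^ (p - 1) + β ^ (q - 1) < cPlus p q Lp := by
    have h1 : 0 < Lp / β := by positivity
    nlinarith
  obtain ⟨Q, hQ⟩ := exists_isProfile hΨ hf (by linarith : 0 ≤ cPlus p q Lp)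
  have hQ0 : Q 0 = 0 := by
    refine le_antisymm ?_ hQ.zero_nonneg
    have h1 := hQ.le_power hq hqp hΨ hf hβ hfL hβc 0 ⟨le_rfl, zero_le_one⟩
    rwa [Real.zero_rpow (by linarith), mul_zero, mul_zero, add_zero] at h1
  obtain ⟨cstar, hpos, hle, hiff⟩ := exists_critical_speed hΨ hf hQ hQ0
  obtain ⟨S, hS⟩ := exists_isProfile hΨ hf hpos.le
  have hS0 : S 0 = 0 := (hiff cstar S hpos.le hS).2 le_rfl
  refine ⟨cstar, hS.lower_bound hq hqp hΨ hf hS0 hL₀, hle, fun c => ⟨?_, fun hc => ?_⟩,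
    fun c hc hcase => ?_⟩
  · rintro ⟨v, hv⟩
    have hc := (hv.speed_pos hΨ hf).le
    obtain ⟨P, hP⟩ := exists_isProfile hΨ hf hc
    exact (hiff c P hc hP).1 (hv.profile_map_zero hΨ hf hP)
  · have hc0 : 0 ≤ c := hpos.le.trans hc
    obtain ⟨P, hP⟩ := exists_isProfile hΨ hf hc0
    obtain ⟨v, hv, -⟩ := hP.exists_isMonotoneFront hΨ hf ((hiff c P hc0 hP).2 hc)
    exact ⟨v, hv⟩
  · have hc0 : 0 ≤ c := hpos.le.trans hc
    obtain ⟨P, hP⟩ := exists_isProfile hΨ hf hc0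
    have hP0 : P 0 = 0 := (hiff c P hc0 hP).2 hc
    rcases hq.eq_or_lt with rfl | hq2
    · refine hP.exists_isStrictFront_of_local le_rfl hqp hΨ hf hP0 hk hfk one_pos (γ := c) ?_
      exact fun u hu => (hΨ.le_self hqp (hP.nonneg u hu)).trans (hP.le_mul hΨ hf hP0 u hu)
    · have hslope : ∃ c' < c, ∀ u ∈ Ioc (0 : ℝ) 1, P u ≤ c' * u := by
        rcases hcase with h2 | hlt | rfl
        · exact absurd h2 hq2.ne'
        · refine ⟨cstar, hlt, fun u hu => ?_⟩
          have hu' := Ioc_subset_Icc_self hu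
          exact (IsProfile.anti hΨ hf hc hS hP u hu').trans (hS.le_mul hΨ hf hS0 u hu')
        · refine ⟨_, hβlt, fun u hu => ?_⟩
          have h1 := hP.le_power hq hqp hΨ hf hβ hfL hβc u (Ioc_subset_Icc_self hu)
          have h2 : u ^ ((p - 1) / (q - 1)) ≤ u := by
            simpa using Real.rpow_le_rpow_of_exponent_ge hu.1 hu.2 hr.le
          nlinarith
      obtain ⟨c', hc', hle'⟩ := hslope
      obtain ⟨γ, δ, hδ, -, hγ⟩ := hP.exists_slope_le_mul hq2 hqp hΨ hf hc' one_pos le_rfl hle'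
      exact hP.exists_isStrictFront_of_local hq hqp hΨ hf hP0 hk hfk hδ hγ
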